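/- **Conventions.** Graphs are undirected, may have loops, have a finite or countably infinite vertex set and are locally finite; the degree of $x$ is the number of $y$ with $y\sim x$. A *network* with vertex marks in $\Upsilon$ and edge marks in $\Xi$ (metric spaces) is a graph together with a mark in $\Upsilon$ for each vertex and a mark in $\Xi$ for each edge. $\mathcal N^*_{(\Upsilon,\Xi)}$ is the set of connected rooted networks $(N,o)$ up to isomorphisms preserving root, edges and marks. For $r\in\mathbb N$, $\delta>0$, the pair $(r,\delta)$ is *good* for $(N,o),(N',o')$ if there is a rooted isomorphism between the graphs induced on the balls of radius $r$ around $o$ and $o'$ under which corresponding vertex marks and corresponding edge marks are at distance less than $\delta$. Let $$d([N,o],[N',o'])=\inf\Big\{\tfrac1{1+r}+\delta:(r,\delta)\text{ is good for }(N,o),(N',o')\Big\}\in[0,\infty],\qquad \inf\emptyset=\infty,$$ and give $\mathcal N^*_{(\Upsilon,\Xi)}$ the resulting topology and its Borel $\sigma$-algebra. Let $\mathcal G^*$ (rooted graphs) be the case of trivial one-point mark spaces, and $\mathcal N^*$ the case $\Upsilon=\mathbb R\times\mathbb R$, $\Xi=(0,\infty)$. For a finite network $N$ with vertex set $V\neq\emptyset$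 let $U(N)=\frac1{|V|}\sum_{v\in V}\delta_{[N(v),v]}$, where $N(v)$ is the connected component of $v$. Networks $N_n$ with vertex set $[n]=\{1,\dots,n\}$, $n\ge1$, *converge locally weakly* to a probability measure $\rho$ if $U(N_n)\to\rho$ weakly; for graphs $G_n$ this is understood with trivial marks. Fix probability measures $\mu$ on $(0,\infty)$ and $\pi,\lambda$ on $\mathbb R$. For a graph $G=(V,E)$ let $N^G$ be the random network obtained by giving $G$ i.i.d. edge weights $(\mu_e)_{e\in E}$ of law $\mu$, and vertex marks $(\omega_v,\theta_v(0))_{v\in V}$, where the media variables $(\omega_v)$ are i.i.d. of law $\pi$, the initial conditions $(\theta_v(0))$ are i.i.d. of law $\lambda$, and the three families are independent. Let $\mathcal M(G,o)$ be the law of $[N^G,o]$; this defines a probability kernel $\mathcal M$ from $\mathcal G^*$ to $\mathcal N^*$. For a probability measure $\rho$ on $\mathcal G^*$ let $\rho\mathcal M=\int\mathcal M(G,o)\,d\rho(G,o)$. **Theorem 4.6.** Let $(G_n)_{n\ge1}$ be graphs, $G_n$ having vertex set $[n]$, such that 1. $G_n$ converges locally weakly to a probability measure $\rho$ on $\mathcal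 G^*$; 2. $\max_{v\in[n]}d_v^{G_n}\le n^{\epsilon_n}$ for every $n\geq 1$, where $\epsilon_n\to0$. Let the random networks $N_n$ be defined on a common probability space, $N_n$ being $G_n$ with random marks having, for each $n$, the joint law of the marks of $N^{G_n}$ (the dependence between different $n$ is arbitrary). Then, almost surely, $N_n$ converges locally weakly to $\rho\mathcal M$. -/

import Mathlib

open MeasureTheory ProbabilityTheory Filter Topology
open scoped ENNReal

noncomputable section

/-! ### Graphs, with loops allowed -/

/-- A graph with vertex set `V` and unoriented edges; loops `x ∼ x` are allowed. -/
structure LoopGraph (V : Type) where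
  Adj : V → V → Prop
  symm : ∀ {x y}, Adj x y → Adj y x

namespace LoopGraph

variable {V : Type}

/-- The set of unoriented edges `{x, y}`. -/
def edgeSet (G : LoopGraph V) : Set (Sym2 V) := {e | ∃ x y, e = s(x, y) ∧ G.Adj x y}

theorem mem_edgeSet (G : LoopGraph V) {x y : V} : s(x, y) ∈ G.edgeSet ↔ G.Adj x y := by
  constructor
  · rintro ⟨a, b, hab, h⟩
    rcases Sym2.eq_iff.1 hab with ⟨rfl, rfl⟩ | ⟨rfl, rfl⟩
    · exact h
    · exact G.symm h
  · exact fun h => ⟨x, y, rfl, h⟩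

/-- The edge `{x, y}` of two adjacent vertices. -/
def edge (G : LoopGraph V) {x y : V} (h : G.Adj x y) : G.edgeSet :=
  ⟨s(x, y), G.mem_edgeSet.2 h⟩

/-- The degree of `x` is the number of `y` with `y ∼ x` (so a loop counts once). -/
def degree (G : LoopGraph V) (x : V) : ℕ := {y | G.Adj y x}.ncard

/-- Deleting the loops, which affects neither distances nor connectivity. -/
def loopless (G : LoopGraph V) : SimpleGraph V where
  Adj x y := x ≠ y ∧ G.Adj x y
  symm := ⟨fun _ _ h => ⟨h.1.symm, G.symm h.2⟩⟩
  loopless := ⟨fun _ h => h.1 rfl⟩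

/-- Vertices within graph distance `r` from `o`. -/
def ball (G : LoopGraph V) (o : V) (r : ℕ) : Set V := {x | G.loopless.edist o x ≤ r}

/-- Vertices of the connected component of `o`. -/
def component (G : LoopGraph V) (o : V) : Set V := {x | G.loopless.Reachable o x}

/-- The subgraph induced by a set of vertices. -/
def induce (G : LoopGraph V) (S : Set V) : LoopGraph S where
  Adj x y := G.Adj x y
  symm h := G.symm h

theorem map_mem_edgeSet (G : LoopGraph V) (S : Set V) {e : Sym2 S}
    (he : e ∈ (G.induce S).edgeSet) : e.map Subtype.val ∈ G.edgeSet := by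
  induction e with
  | _ x y =>
    rw [mem_edgeSet] at he
    exact G.mem_edgeSet.2 he

end LoopGraph

/-! ### Networks -/

/-- A network on the vertex set `V`: a graph with vertex marks in `Υ` and edge marks in `Ξ`. -/
structure Network (V Υ Ξ : Type) where
  graph : LoopGraph V
  vmark : V → Υ
  emark : graph.edgeSet → Ξ

/-- The subnetwork induced by a set of vertices. -/
def Network.induce {V Υ Ξ : Type} (N : Network V Υ Ξ) (S : Set V) : Network S Υ Ξ where
  graph := N.graph.induce S
  vmark x := N.vmark x
  emark e := N.emark ⟨e.1.map Subtype.val, N.graph.map_mem_edgeSet S e.2⟩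

/-- A rooted network: a countable, locally finite, connected network with a distinguished vertex. -/
structure RootedNetwork (Υ Ξ : Type) where
  V : Type
  countable : Countable V
  net : Network V Υ Ξ
  root : V
  locallyFinite : ∀ x, {y | net.graph.Adj y x}.Finite
  connected : net.graph.loopless.Connected

/-- Rooted graphs are rooted networks with trivial marks. -/
abbrev RootedGraph := RootedNetwork Unit Unit

namespace RootedNetwork

variable {Υ Ξ : Type}

/-- The underlying graph. -/
abbrev graph (N : RootedNetwork Υ Ξ) : LoopGraph N.V := N.net.graph

/-- The ball of radius `r` around the root. -/
abbrev ball (N : RootedNetwork Υ Ξ) (r : ℕ) : Set N.V := N.graph.ball N.root r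

/-- Rooted isomorphism: a bijection of the vertices preserving the root, the edges and the marks. -/
def Iso (N N' : RootedNetwork Υ Ξ) : Prop :=
  ∃ Ψ : N.V ≃ N'.V, Ψ N.root = N'.root ∧
    (∀ x y, N.graph.Adj x y ↔ N'.graph.Adj (Ψ x) (Ψ y)) ∧
    (∀ x, N'.net.vmark (Ψ x) = N.net.vmark x) ∧
    ∀ x y (h : N.graph.Adj x y) (h' : N'.graph.Adj (Ψ x) (Ψ y)),
      N'.net.emark (N'.graph.edge h') = N.net.emark (N.graph.edge h)

instance setoid (Υ Ξ : Type) : Setoid (RootedNetwork Υ Ξ) where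
  r := Iso
  iseqv := by
    refine ⟨fun N => ⟨Equiv.refl _, rfl, fun _ _ => Iff.rfl, fun _ => rfl, fun _ _ _ _ => rfl⟩,
      ?_, ?_⟩
    · rintro N N' ⟨Ψ, h0, hA, hv, he⟩
      refine ⟨Ψ.symm, by simp [← h0], fun x y => by simp [hA], fun x => ?_, fun x y h h' => ?_⟩
      · simp [← hv]
      · have h2 : N'.graph.Adj (Ψ (Ψ.symm x)) (Ψ (Ψ.symm y)) := by simpa using h
        have := he _ _ h' h2
        rw [← this]
        congr 2 <;> simp
    · rintro N N' N'' ⟨Ψ, h0, hA, hv, he⟩ ⟨Φ, k0, kA, kv, ke⟩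
      refine ⟨Ψ.trans Φ, by simp [h0, k0], fun x y => by simp [hA, kA],
        fun x => by simp [kv, hv], fun x y h h' => ?_⟩
      have h1 := (hA x y).1 h
      rw [← he x y h h1]
      exact ke _ _ h1 h'

theorem root_mem_ball (N : RootedNetwork Υ Ξ) (r : ℕ) : N.root ∈ N.ball r := by
  simp [LoopGraph.ball]

variable [PseudoMetricSpace Υ] [PseudoMetricSpace Ξ]

/-- The pair `(r, δ)` is good for two rooted networks: there is a rooted isomorphism of the graphs
induced by the `r`-balls under which corresponding marks are at distance less than `δ`. -/
def Good (N N' : RootedNetwork Υ Ξ) (r : ℕ) (δ : ℝ) : Prop :=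
  ∃ Ψ : N.ball r ≃ N'.ball r,
    (∀ x, x.1 = N.root → (Ψ x).1 = N'.root) ∧
    (∀ x y : N.ball r, N.graph.Adj x y ↔ N'.graph.Adj (Ψ x) (Ψ y)) ∧
    (∀ x : N.ball r, dist (N.net.vmark x) (N'.net.vmark (Ψ x)) < δ) ∧
    ∀ (x y : N.ball r) (h : N.graph.Adj x y) (h' : N'.graph.Adj (Ψ x) (Ψ y)),
      dist (N.net.emark (N.graph.edge h)) (N'.net.emark (N'.graph.edge h')) < δ

/-- The local distance: the infimum of `1 / (1 + r) + δ` over all good pairs `(r, δ)`.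
It is infinite if there is no good pair, that is, if exactly one of the roots has a loop. -/
def localEDist (N N' : RootedNetwork Υ Ξ) : ℝ≥0∞ :=
  ⨅ (r : ℕ) (δ : ℝ) (_ : 0 < δ ∧ Good N N' r δ), ENNReal.ofReal (1 / (1 + (r : ℝ)) + δ)

end RootedNetwork

namespace LoopGraph

variable {V : Type}

theorem mem_ball_zero (G : LoopGraph V) {o x : V} : x ∈ G.ball o 0 ↔ x = o := by
  simp [ball]

theorem ball_mono (G : LoopGraph V) (o : V) {r s : ℕ} (h : r ≤ s) : G.ball o r ⊆ G.ball o s := by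
  intro x hx
  exact le_trans (show G.loopless.edist o x ≤ r from hx) (by exact_mod_cast h)

theorem mem_ball_succ (G : LoopGraph V) {o x : V} {r : ℕ} :
    x ∈ G.ball o (r + 1) ↔ x ∈ G.ball o r ∨ ∃ y ∈ G.ball o r, G.Adj y x := by
  constructor
  · intro h
    have h : G.loopless.edist o x ≤ ((r + 1 : ℕ) : ℕ∞) := h
    have hne : G.loopless.edist o x ≠ ⊤ := ne_top_of_le_ne_top (ENat.natCast_ne_top _) h
    obtain ⟨p, hp⟩ := SimpleGraph.exists_walk_of_edist_ne_top hne
    rw [← hp] at h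
    have h : p.length ≤ r + 1 := by exact_mod_cast h
    rcases Nat.lt_or_ge r p.length with hlt | hge
    · right
      have hlen : p.reverse.length = r + 1 := by simp; omega
      generalize p.reverse = q at hlen
      cases q with
      | nil => simp at hlen
      | cons hadj q' =>
        refine ⟨_, ?_, G.symm hadj.2⟩
        have := SimpleGraph.edist_le q'.reverse
        simp at hlen
        simpa [ball, hlen] using this
    · left
      exact le_trans (SimpleGraph.edist_le p) (by exact_mod_cast hge)
  · rintro (h | ⟨y, hy, hyx⟩)
    · exact G.ball_mono o (Nat.le_succ r) h
    · by_cases hxy : y = x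
      · subst hxy
        exact G.ball_mono o (Nat.le_succ r) hy
      · have h1 : G.loopless.edist y x = 1 :=
          SimpleGraph.edist_eq_one_iff_adj.2 ⟨hxy, hyx⟩
        calc G.loopless.edist o x ≤ G.loopless.edist o y + G.loopless.edist y x :=
              SimpleGraph.edist_triangle
          _ ≤ r + 1 := by rw [h1]; gcongr; exact hy
          _ = ((r + 1 : ℕ) : ℕ∞) := by push_cast; rfl

theorem ball_finite (G : LoopGraph V) (hG : ∀ x, {y | G.Adj y x}.Finite) (o : V) (r : ℕ) :
    (G.ball o r).Finite := by
  induction r with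
  | zero =>
    refine (Set.finite_singleton o).subset fun x hx => ?_
    simpa using G.mem_ball_zero.1 hx
  | succ r ih =>
    refine (ih.union (ih.biUnion fun y _ => hG y)).subset fun x hx => ?_
    rcases G.mem_ball_succ.1 hx with h | ⟨y, hy, hyx⟩
    · exact Or.inl h
    · exact Or.inr (Set.mem_biUnion hy (G.symm hyx))

end LoopGraph

namespace RootedNetwork

variable {Υ Ξ : Type}

theorem map_mem_ball {N N' : RootedNetwork Υ Ξ} {r : ℕ} (Ψ : N.ball r ≃ N'.ball r)
    (h0 : ∀ x, x.1 = N.root → (Ψ x).1 = N'.root)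
    (hA : ∀ x y : N.ball r, N.graph.Adj x y ↔ N'.graph.Adj (Ψ x) (Ψ y)) {s : ℕ} (hs : s ≤ r)
    (x : N.ball r) (hx : x.1 ∈ N.ball s) : (Ψ x).1 ∈ N'.ball s := by
  induction s generalizing x with
  | zero => exact (LoopGraph.mem_ball_zero _).2 (h0 x ((LoopGraph.mem_ball_zero _).1 hx))
  | succ s ih =>
    rcases (LoopGraph.mem_ball_succ _).1 hx with h | ⟨y, hy, hyx⟩
    · exact (LoopGraph.mem_ball_succ _).2 (Or.inl (ih (by omega) x h))
    · let y' : N.ball r := ⟨y, LoopGraph.ball_mono _ _ (by omega) hy⟩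
      exact (LoopGraph.mem_ball_succ _).2
        (Or.inr ⟨Ψ y', ih (by omega) y' hy, (hA y' x).1 hyx⟩)

variable [PseudoMetricSpace Υ] [PseudoMetricSpace Ξ]

theorem Good.refl (N : RootedNetwork Υ Ξ) (r : ℕ) {δ : ℝ} (hδ : 0 < δ) : Good N N r δ :=
  ⟨Equiv.refl _, fun _ h => h, fun _ _ => Iff.rfl, fun _ => by simpa using hδ,
    fun _ _ _ _ => by simpa using hδ⟩

theorem Good.symm {N N' : RootedNetwork Υ Ξ} {r : ℕ} {δ : ℝ} (h : Good N N' r δ) :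
    Good N' N r δ := by
  obtain ⟨Ψ, h0, hA, hv, he⟩ := h
  refine ⟨Ψ.symm, ?_, fun x y => ?_, fun x => ?_, fun x y h h' => ?_⟩
  · intro x hx
    have := h0 ⟨N.root, N.root_mem_ball r⟩ rfl
    have hx' : Ψ ⟨N.root, N.root_mem_ball r⟩ = x := Subtype.ext (this.trans hx.symm)
    rw [← hx']
    simp
  · simp [hA]
  · simpa [dist_comm] using hv (Ψ.symm x)
  · have h2 : N'.graph.Adj (Ψ (Ψ.symm x)) (Ψ (Ψ.symm y)) := by simpa using h
    have := he _ _ h' h2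
    rw [dist_comm]
    convert this using 4 <;> simp

theorem Good.mono {N N' : RootedNetwork Υ Ξ} {r s : ℕ} {δ : ℝ} (h : Good N N' r δ) (hs : s ≤ r) :
    Good N N' s δ := by
  obtain ⟨Ψ, h0, hA, hv, he⟩ := h
  have h0' : ∀ x, x.1 = N'.root → (Ψ.symm x).1 = N.root := by
    intro x hx
    have := h0 ⟨N.root, N.root_mem_ball r⟩ rfl
    have hx' : Ψ ⟨N.root, N.root_mem_ball r⟩ = x := Subtype.ext (this.trans hx.symm)
    rw [← hx']
    simp
  have hA' : ∀ x y : N'.ball r, N'.graph.Adj x y ↔ N.graph.Adj (Ψ.symm x) (Ψ.symm y) := by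
    intro x y
    simp [hA]
  let i : N.ball s → N.ball r := fun x => ⟨x.1, LoopGraph.ball_mono _ _ hs x.2⟩
  let i' : N'.ball s → N'.ball r := fun x => ⟨x.1, LoopGraph.ball_mono _ _ hs x.2⟩
  let Φ : N.ball s ≃ N'.ball s :=
    { toFun := fun x => ⟨Ψ (i x), map_mem_ball Ψ h0 hA hs (i x) x.2⟩
      invFun := fun x => ⟨Ψ.symm (i' x), map_mem_ball Ψ.symm h0' hA' hs (i' x) x.2⟩
      left_inv := fun x => by simp [i, i']
      right_inv := fun x => by simp [i, i'] }
  exact ⟨Φ, fun x hx => h0 (i x) hx, fun x y => hA (i x) (i y), fun x => hv (i x),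
    fun x y h h' => he (i x) (i y) h h'⟩

theorem Good.trans {N N' N'' : RootedNetwork Υ Ξ} {r : ℕ} {δ δ' : ℝ} (h : Good N N' r δ)
    (h' : Good N' N'' r δ') : Good N N'' r (δ + δ') := by
  obtain ⟨Ψ, h0, hA, hv, he⟩ := h
  obtain ⟨Φ, k0, kA, kv, ke⟩ := h'
  refine ⟨Ψ.trans Φ, fun x hx => k0 _ (h0 x hx), fun x y => (hA x y).trans (kA _ _), fun x => ?_,
    fun x y h h' => ?_⟩
  · exact (dist_triangle _ _ _).trans_lt (add_lt_add (hv x) (kv (Ψ x)))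
  · have h1 := (hA x y).1 h
    exact (dist_triangle _ _ _).trans_lt (add_lt_add (he x y h h1) (ke _ _ h1 h'))

theorem Iso.good {N N' : RootedNetwork Υ Ξ} (h : Iso N N') (r : ℕ) {δ : ℝ} (hδ : 0 < δ) :
    Good N N' r δ := by
  obtain ⟨Ψ, h0, hA, hv, he⟩ := h
  have key : ∀ (s : ℕ) (x : N.V), x ∈ N.ball s ↔ Ψ x ∈ N'.ball s := by
    intro s
    induction s with
    | zero =>
      intro x
      rw [LoopGraph.mem_ball_zero, LoopGraph.mem_ball_zero, ← h0]
      simp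
    | succ s ih =>
      intro x
      rw [LoopGraph.mem_ball_succ, LoopGraph.mem_ball_succ, ih x]
      refine or_congr Iff.rfl ⟨?_, ?_⟩
      · rintro ⟨y, hy, hyx⟩
        exact ⟨Ψ y, (ih y).1 hy, (hA _ _).1 hyx⟩
      · rintro ⟨y, hy, hyx⟩
        refine ⟨Ψ.symm y, (ih _).2 (by simpa using hy), (hA _ _).2 (by simpa using hyx)⟩
  refine ⟨Ψ.subtypeEquiv (key r), ?_, fun x y => hA x y, fun x => ?_, fun x y h h' => ?_⟩
  · intro x hx
    simp [hx, h0]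
  · have := hv x
    simp [this, hδ]
  · have : N'.net.emark (N'.graph.edge h') = N.net.emark (N.graph.edge h) := he x y h h'
    rw [this]
    simpa using hδ

theorem localEDist_le {N N' : RootedNetwork Υ Ξ} {r : ℕ} {δ : ℝ} (hδ : 0 < δ)
    (h : Good N N' r δ) : localEDist N N' ≤ ENNReal.ofReal (1 / (1 + (r : ℝ)) + δ) :=
  iInf₂_le_of_le r δ (iInf_le _ ⟨hδ, h⟩)

theorem localEDist_lt_iff {N N' : RootedNetwork Υ Ξ} {c : ℝ≥0∞} : localEDist N N' < c ↔
    ∃ (r : ℕ) (δ : ℝ), (0 < δ ∧ Good N N' r δ) ∧ ENNReal.ofReal (1 / (1 + (r : ℝ)) + δ) < c := by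
  simp [localEDist, iInf_lt_iff]

theorem localEDist_le_of_forall_good {N N' : RootedNetwork Υ Ξ} {r : ℕ}
    (h : ∀ δ : ℝ, 0 < δ → Good N N' r δ) :
    localEDist N N' ≤ ENNReal.ofReal (1 / (1 + (r : ℝ))) := by
  refine ENNReal.le_of_forall_pos_le_add fun ε hε _ => ?_
  refine (localEDist_le (δ := ε) (by exact_mod_cast hε) (h ε (by exact_mod_cast hε))).trans ?_
  rw [ENNReal.ofReal_add (by positivity) (by positivity)]
  simp

theorem exists_radius {c : ℝ≥0∞} (hc : c ≠ 0) :
    ∃ r : ℕ, ENNReal.ofReal (1 / (1 + (r : ℝ))) < c := by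
  have h : Tendsto (fun r : ℕ => ENNReal.ofReal (1 / (1 + (r : ℝ)))) atTop (𝓝 0) := by
    have := (tendsto_one_div_add_atTop_nhds_zero_nat (𝕜 := ℝ))
    have := ENNReal.tendsto_ofReal this
    simpa [add_comm] using this
  exact (h.eventually_lt_const (pos_iff_ne_zero.2 hc)).exists

theorem localEDist_eq_zero_of_forall_good {N N' : RootedNetwork Υ Ξ}
    (h : ∀ (r : ℕ) (δ : ℝ), 0 < δ → Good N N' r δ) : localEDist N N' = 0 := by
  by_contra hne
  obtain ⟨r, hr⟩ := exists_radius hne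
  exact absurd (localEDist_le_of_forall_good (h r)) (not_le.2 hr)

/-- The local distance satisfies the axioms of an extended pseudometric. -/
instance : PseudoEMetricSpace (RootedNetwork Υ Ξ) where
  edist := localEDist
  edist_self N := localEDist_eq_zero_of_forall_good fun r _ hδ => Good.refl N r hδ
  edist_comm N N' := by
    refine le_antisymm ?_ ?_ <;>
    exact le_iInf₂ fun r δ => le_iInf fun h => localEDist_le h.1 h.2.symm
  edist_triangle N N' N'' := by
    rw [localEDist, localEDist, localEDist]
    simp only [ENNReal.iInf_add, ENNReal.add_iInf, le_iInf_iff]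
    intro r' δ' h' r δ h
    have hg : Good N N'' (min r r') (δ + δ') :=
      (h.2.mono (min_le_left _ _)).trans (h'.2.mono (min_le_right _ _))
    refine (localEDist_le (by linarith [h.1, h'.1]) hg).trans ?_
    have h1 := h.1
    have h2 := h'.1
    rw [← ENNReal.ofReal_add (by positivity) (by positivity)]
    apply ENNReal.ofReal_le_ofReal
    have p1 : 0 < 1 / (1 + (r : ℝ)) := by positivity
    have p2 : 0 < 1 / (1 + (r' : ℝ)) := by positivity
    rcases min_choice r r' with e | e <;> rw [e] <;> linarith

theorem edist_def (N N' : RootedNetwork Υ Ξ) : edist N N' = localEDist N N' := rfl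

theorem edist_eq_zero_of_iso {N N' : RootedNetwork Υ Ξ} (h : Iso N N') : edist N N' = 0 :=
  localEDist_eq_zero_of_forall_good fun r _ hδ => h.good r hδ

theorem edist_congr {N N' M M' : RootedNetwork Υ Ξ} (h : Iso N N') (h' : Iso M M') :
    edist N M = edist N' M' := by
  have hN := edist_eq_zero_of_iso h
  have hM := edist_eq_zero_of_iso h'
  apply le_antisymm
  · calc edist N M ≤ edist N N' + edist N' M' + edist M' M := edist_triangle4 _ _ _ _
      _ = edist N' M' := by rw [edist_comm M' M, hN, hM]; simp
  · calc edist N' M' ≤ edist N' N + edist N M + edist M M' := edist_triangle4 _ _ _ _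
      _ = edist N M := by rw [edist_comm N' N, hN, hM]; simp

end RootedNetwork

/-! ### The space of rooted networks up to isomorphism -/

/-- Rooted networks up to rooted isomorphism. -/
def NetClass (Υ Ξ : Type) : Type 1 := Quotient (RootedNetwork.setoid Υ Ξ)

/-- Rooted graphs up to rooted isomorphism. -/
abbrev GraphClass : Type 1 := NetClass Unit Unit

namespace NetClass

variable {Υ Ξ : Type}

/-- The equivalence class of a rooted network. -/
def mk (N : RootedNetwork Υ Ξ) : NetClass Υ Ξ := Quotient.mk _ N

variable [PseudoMetricSpace Υ] [PseudoMetricSpace Ξ]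

/-- The local distance of two classes is the distance of any two representatives. -/
instance : PseudoEMetricSpace (NetClass Υ Ξ) where
  edist := Quotient.lift₂ (fun N N' : RootedNetwork Υ Ξ => edist N N')
    fun _ _ _ _ h h' => RootedNetwork.edist_congr h h'
  edist_self x := Quotient.inductionOn x fun N => edist_self N
  edist_comm x y := Quotient.inductionOn₂ x y fun N M => edist_comm N M
  edist_triangle x y z := Quotient.inductionOn₃ x y z fun N M K => edist_triangle N M K

theorem edist_mk (N N' : RootedNetwork Υ Ξ) : edist (mk N) (mk N') = edist N N' := rfl

instance : MeasurableSpace (NetClass Υ Ξ) := borel _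

instance : BorelSpace (NetClass Υ Ξ) := ⟨rfl⟩

end NetClass

/-! ### Local weak convergence -/

/-- The connected component of `v` in a finite network, rooted at `v`. -/
def Network.componentAt {V Υ Ξ : Type} [Finite V] (N : Network V Υ Ξ) (v : V) :
    RootedNetwork Υ Ξ where
  V := N.graph.component v
  countable := inferInstance
  net := N.induce (N.graph.component v)
  root := ⟨v, SimpleGraph.Reachable.refl v⟩
  locallyFinite _ := Set.toFinite _
  connected := by
    have : Nonempty (N.graph.component v) := ⟨⟨v, SimpleGraph.Reachable.refl v⟩⟩
    have key : ∀ {x y : V} (p : N.graph.loopless.Walk x y) (hx : x ∈ N.graph.component v)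
        (hy : y ∈ N.graph.component v),
        (N.induce (N.graph.component v)).graph.loopless.Reachable ⟨x, hx⟩ ⟨y, hy⟩ := by
      intro x y p
      induction p with
      | nil => exact fun _ _ => SimpleGraph.Reachable.refl _
      | @cons x z y h p ih =>
        intro hx hy
        have hz : z ∈ N.graph.component v := SimpleGraph.Reachable.trans hx h.reachable
        refine SimpleGraph.Reachable.trans (SimpleGraph.Adj.reachable ?_) (ih hz hy)
        exact ⟨fun e => h.1 (congrArg Subtype.val e), h.2⟩
    constructor
    intro x y
    obtain ⟨p⟩ := SimpleGraph.Reachable.trans (SimpleGraph.Reachable.symm x.2) y.2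
    exact key p x.2 y.2

section Empirical

variable {Υ Ξ : Type} [PseudoMetricSpace Υ] [PseudoMetricSpace Ξ]

/-- The empirical neighbourhood measure of a finite network: the average over the vertices `v` of
the Dirac masses at the classes of `(N(v), v)`. -/
def Network.empirical {V : Type} [Fintype V] [Nonempty V] (N : Network V Υ Ξ) :
    ProbabilityMeasure (NetClass Υ Ξ) :=
  ⟨(Fintype.card V : ℝ≥0∞)⁻¹ • ∑ v : V, Measure.dirac (NetClass.mk (N.componentAt v)), ⟨by
    simp [ENNReal.inv_mul_cancel]⟩⟩

/-- Local weak convergence of finite networks `N n` on `n` vertices, `n ≥ 1`: weak convergence of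
the empirical neighbourhood measures. -/
def LocallyWeaklyConverges (N : (n : ℕ+) → Network (Fin n) Υ Ξ)
    (ρ : ProbabilityMeasure (NetClass Υ Ξ)) : Prop :=
  Tendsto (fun n => (N n).empirical) atTop (𝓝 ρ)

end Empirical

/-- A graph, seen as a network with trivial marks. -/
def LoopGraph.bare {V : Type} (G : LoopGraph V) : Network V Unit Unit where
  graph := G
  vmark _ := ()
  emark _ := ()

/-! ### Random marks -/

/-- The weights `μ`, the media variables `ω` and the initial conditions `θ(0)` on a graph. -/
abbrev LoopGraph.Marks {V : Type} (G : LoopGraph V) : Type :=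
  (G.edgeSet → Set.Ioi (0 : ℝ)) × (V → ℝ) × (V → ℝ)

/-- The network `(G, μ, ω, θ(0))`. -/
def LoopGraph.decorate {V : Type} (G : LoopGraph V) (m : G.Marks) :
    Network V (ℝ × ℝ) (Set.Ioi (0 : ℝ)) where
  graph := G
  vmark v := (m.2.1 v, m.2.2 v)
  emark e := m.1 e

/-- Rooted networks with positive edge weights and vertex marks in `ℝ × ℝ`, up to isomorphism. -/
abbrev DiffNetClass : Type 1 := NetClass (ℝ × ℝ) (Set.Ioi (0 : ℝ))

/-- The rooted network obtained from a rooted graph by adding marks. -/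
def RootedNetwork.decorate (g : RootedGraph) (m : g.graph.Marks) :
    RootedNetwork (ℝ × ℝ) (Set.Ioi (0 : ℝ)) where
  V := g.V
  countable := g.countable
  net := g.graph.decorate m
  root := g.root
  locallyFinite := g.locallyFinite
  connected := g.connected

/-- The law of independent marks: i.i.d. weights with law `wgt`, i.i.d. media variables with law
`med` and i.i.d. initial conditions with law `ini`, the three families being independent. -/
def LoopGraph.iidMarks {V : Type} (G : LoopGraph V) (wgt : ProbabilityMeasure (Set.Ioi (0 : ℝ)))
    (med ini : ProbabilityMeasure ℝ) : Measure G.Marks :=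
  (Measure.infinitePi fun _ : G.edgeSet => (wgt : Measure (Set.Ioi (0 : ℝ)))).prod
    ((Measure.infinitePi fun _ : V => (med : Measure ℝ)).prod
      (Measure.infinitePi fun _ : V => (ini : Measure ℝ)))

instance {V : Type} (G : LoopGraph V) (wgt : ProbabilityMeasure (Set.Ioi (0 : ℝ)))
    (med ini : ProbabilityMeasure ℝ) : IsProbabilityMeasure (G.iidMarks wgt med ini) := by
  unfold LoopGraph.iidMarks
  infer_instance

/-! ### The mark kernel -/

theorem map_comp_infinitePi {ι β X : Type} [MeasurableSpace X] (p : Measure X)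
    [IsProbabilityMeasure p] {f : β → ι} (hf : Function.Injective f) :
    MeasurePreserving (fun (m : ι → X) (b : β) => m (f b)) (Measure.infinitePi fun _ : ι => p)
      (Measure.infinitePi fun _ : β => p) := by
  have hmeas : Measurable (fun (m : ι → X) (b : β) => m (f b)) := by fun_prop
  refine ⟨hmeas, Measure.eq_infinitePi _ fun s t ht => ?_⟩
  classical
  rw [Measure.map_apply hmeas (MeasurableSet.pi s.countable_toSet fun i _ => ht i)]
  have : (fun (m : ι → X) (b : β) => m (f b)) ⁻¹' (Set.pi s t) =
      Set.pi (s.image f) (Function.extend f t fun _ => Set.univ) := by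
    ext m
    simp [Set.mem_pi, hf.extend_apply]
  rw [this, Measure.infinitePi_pi]
  · rw [Finset.prod_image fun a _ b _ h => hf h]
    simp [hf.extend_apply]
  · intro i hi
    obtain ⟨b, -, rfl⟩ := Finset.mem_image.1 hi
    rw [hf.extend_apply]
    exact ht b

theorem measurable_extend {ι β X : Type} [MeasurableSpace X] {f : β → ι}
    (hf : Function.Injective f) (d : X) :
    Measurable (fun x : β → X => Function.extend f x fun _ => d) := by
  rw [measurable_pi_iff]
  intro i
  by_cases hi : ∃ b, f b = i
  · obtain ⟨b, rfl⟩ := hi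
    simp only [hf.extend_apply]
    exact measurable_pi_apply b
  · simp only [Function.extend_apply' _ _ _ hi]
    exact measurable_const

namespace RootedNetwork

/-- The class of the rooted network obtained from a rooted graph by adding marks. -/
def decorateClass (g : RootedGraph) (m : g.graph.Marks) : DiffNetClass :=
  NetClass.mk (g.decorate m)

theorem ball_finite {Υ Ξ : Type} (N : RootedNetwork Υ Ξ) (r : ℕ) : (N.ball r).Finite :=
  N.graph.ball_finite N.locallyFinite N.root r

theorem continuous_decorateClass (g : RootedGraph) : Continuous g.decorateClass := by
  rw [continuous_iff_continuousAt]
  intro m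
  rw [ContinuousAt, EMetric.tendsto_nhds]
  intro c hc
  obtain ⟨r, hr⟩ := exists_radius (pos_iff_ne_zero.1 hc)
  obtain ⟨δ, hδ0, hδ⟩ : ∃ δ : ℝ, 0 < δ ∧ ENNReal.ofReal (1 / (1 + (r : ℝ)) + δ) < c := by
    have h1 : Tendsto (fun δ : ℝ => ENNReal.ofReal (1 / (1 + (r : ℝ)) + δ)) (𝓝[>] 0)
        (𝓝 (ENNReal.ofReal (1 / (1 + (r : ℝ)) + 0))) := by
      apply ENNReal.tendsto_ofReal
      exact (tendsto_const_nhds.add tendsto_id).mono_left nhdsWithin_le_nhds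
    rw [add_zero] at h1
    obtain ⟨δ, h, h'⟩ := ((h1.eventually_lt_const hr).and self_mem_nhdsWithin).exists
    exact ⟨δ, h', h⟩
  have hfin := g.ball_finite r
  have : Finite (g.ball r) := hfin
  have hv : ∀ᶠ m' : g.graph.Marks in 𝓝 m, ∀ x : g.ball r,
      dist ((m'.2.1 x, m'.2.2 x) : ℝ × ℝ) (m.2.1 x, m.2.2 x) < δ := by
    rw [eventually_all]
    intro x
    have hc : Continuous fun m' : g.graph.Marks =>
        dist ((m'.2.1 x, m'.2.2 x) : ℝ × ℝ) (m.2.1 x, m.2.2 x) := by fun_prop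
    exact (hc.tendsto m).eventually_lt_const (by simpa using hδ0)
  have he : ∀ᶠ m' : g.graph.Marks in 𝓝 m, ∀ (x y : g.ball r) (h : g.graph.Adj x y),
      dist (m'.1 (g.graph.edge h)) (m.1 (g.graph.edge h)) < δ := by
    simp only [eventually_all]
    intro x y h
    have hc : Continuous fun m' : g.graph.Marks =>
        dist (m'.1 (g.graph.edge h)) (m.1 (g.graph.edge h)) := by fun_prop
    exact (hc.tendsto m).eventually_lt_const (by simpa using hδ0)
  filter_upwards [hv, he] with m' hv he
  refine lt_of_le_of_lt ?_ hδ
  refine localEDist_le (N := g.decorate m') (N' := g.decorate m) hδ0 ?_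
  exact ⟨Equiv.refl _, fun _ h => h, fun _ _ => Iff.rfl, hv, fun x y h _ => he x y h⟩

theorem measurable_decorateClass (g : RootedGraph) : Measurable g.decorateClass := by
  have : Countable g.V := g.countable
  have : Countable (Sym2 g.V) := Quotient.countable
  exact g.continuous_decorateClass.measurable

theorem edist_decorateClass_le {g g' : RootedGraph} {r : ℕ} (Ψ : g.ball r ≃ g'.ball r)
    (h0 : ∀ x, x.1 = g.root → (Ψ x).1 = g'.root)
    (hA : ∀ x y : g.ball r, g.graph.Adj x y ↔ g'.graph.Adj (Ψ x) (Ψ y))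
    (m : g.graph.Marks) (m' : g'.graph.Marks)
    (h1 : ∀ x : g.ball r, m'.2.1 (Ψ x) = m.2.1 x) (h2 : ∀ x : g.ball r, m'.2.2 (Ψ x) = m.2.2 x)
    (h3 : ∀ (x y : g.ball r) (h : g.graph.Adj x y) (h' : g'.graph.Adj (Ψ x) (Ψ y)),
      m'.1 (g'.graph.edge h') = m.1 (g.graph.edge h)) :
    edist (g.decorateClass m) (g'.decorateClass m') ≤ ENNReal.ofReal (1 / (1 + (r : ℝ))) := by
  refine localEDist_le_of_forall_good (N := g.decorate m) (N' := g'.decorate m') fun δ hδ => ?_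
  have hv : ∀ x : g.ball r, dist ((m.2.1 x, m.2.2 x) : ℝ × ℝ) (m'.2.1 (Ψ x), m'.2.2 (Ψ x)) < δ := by
    intro x
    rw [h1, h2, dist_self]
    exact hδ
  have he : ∀ (x y : g.ball r) (h : g.graph.Adj x y) (h' : g'.graph.Adj (Ψ x) (Ψ y)),
      dist (m.1 (g.graph.edge h)) (m'.1 (g'.graph.edge h')) < δ := by
    intro x y h h'
    rw [h3 x y h h', dist_self]
    exact hδ
  exact ⟨Ψ, h0, hA, hv, he⟩

/-- Marks on the `r`-ball can be transferred between graphs with isomorphic `r`-balls. -/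
theorem iidMarks_transfer (wgt : ProbabilityMeasure (Set.Ioi (0 : ℝ)))
    (med ini : ProbabilityMeasure ℝ) {g g' : RootedGraph} {r : ℕ} {δ₀ : ℝ} (h : Good g g' r δ₀)
    {A : Set DiffNetClass} (hA : IsClosed A) :
    g.graph.iidMarks wgt med ini {m | ∀ x : DiffNetClass,
        edist (g.decorateClass m) x ≤ ENNReal.ofReal (1 / (1 + (r : ℝ))) → x ∈ A} ≤
      g'.graph.iidMarks wgt med ini {m' | ∃ x ∈ A,
        edist x (g'.decorateClass m') ≤ ENNReal.ofReal (1 / (1 + (r : ℝ)))} := by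
  obtain ⟨Ψ, h0, hAdj, -, -⟩ := h
  let H : LoopGraph (g'.ball r) := g'.graph.induce (g'.ball r)
  let fE' : H.edgeSet → g'.graph.edgeSet :=
    fun e => ⟨e.1.map Subtype.val, g'.graph.map_mem_edgeSet _ e.2⟩
  let φ : g'.ball r → g.V := fun x => (Ψ.symm x).1
  have hφ : Function.Injective φ := Subtype.val_injective.comp Ψ.symm.injective
  have hmem : ∀ e ∈ H.edgeSet, Sym2.map φ e ∈ g.graph.edgeSet := by
    intro e he
    induction e with
    | _ x y =>
      rw [LoopGraph.mem_edgeSet] at he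
      refine g.graph.mem_edgeSet.2 ((hAdj _ _).2 ?_)
      rw [Equiv.apply_symm_apply, Equiv.apply_symm_apply]
      exact he
  let fE : H.edgeSet → g.graph.edgeSet := fun e => ⟨e.1.map φ, hmem e.1 e.2⟩
  have hfE : Function.Injective fE := fun a b hab =>
    Subtype.ext (Sym2.map.injective hφ (congrArg Subtype.val hab))
  have hfE' : Function.Injective fE' := fun a b hab =>
    Subtype.ext (Sym2.map.injective Subtype.val_injective (congrArg Subtype.val hab))
  let p : g.graph.Marks → H.Marks :=
    Prod.map (fun m b => m (fE b)) (Prod.map (fun m b => m (φ b)) (fun m b => m (φ b)))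
  let p' : g'.graph.Marks → H.Marks :=
    Prod.map (fun m b => m (fE' b))
      (Prod.map (fun m (b : g'.ball r) => m b.1) (fun m (b : g'.ball r) => m b.1))
  have hp : MeasurePreserving p (g.graph.iidMarks wgt med ini) (H.iidMarks wgt med ini) :=
    (map_comp_infinitePi _ hfE).prod ((map_comp_infinitePi _ hφ).prod (map_comp_infinitePi _ hφ))
  have hp' : MeasurePreserving p' (g'.graph.iidMarks wgt med ini) (H.iidMarks wgt med ini) :=
    (map_comp_infinitePi _ hfE').prod
      ((map_comp_infinitePi _ Subtype.val_injective).prod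
        (map_comp_infinitePi _ Subtype.val_injective))
  let q : H.Marks → g'.graph.Marks :=
    Prod.map (fun x => Function.extend fE' x fun _ => ⟨1, Set.mem_Ioi.2 one_pos⟩)
      (Prod.map (fun x => Function.extend (Subtype.val : g'.ball r → g'.V) x fun _ => 0)
        (fun x => Function.extend (Subtype.val : g'.ball r → g'.V) x fun _ => 0))
  have hq : Measurable q :=
    (measurable_extend hfE' _).prodMap ((measurable_extend Subtype.val_injective _).prodMap
      (measurable_extend Subtype.val_injective _))
  have hC : MeasurableSet (q ⁻¹' (g'.decorateClass ⁻¹' A)) :=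
    hq (g'.measurable_decorateClass hA.measurableSet)
  have q1 : ∀ (z : H.Marks) (e : H.edgeSet), (q z).1 (fE' e) = z.1 e :=
    fun z e => hfE'.extend_apply z.1 (fun _ => ⟨1, Set.mem_Ioi.2 one_pos⟩) e
  have q2 : ∀ (z : H.Marks) (b : g'.ball r), (q z).2.1 b.1 = z.2.1 b :=
    fun z b => Subtype.val_injective.extend_apply z.2.1 (fun _ => 0) b
  have q3 : ∀ (z : H.Marks) (b : g'.ball r), (q z).2.2 b.1 = z.2.2 b :=
    fun z b => Subtype.val_injective.extend_apply z.2.2 (fun _ => 0) b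
  have d1 : ∀ m : g.graph.Marks, edist (g.decorateClass m) (g'.decorateClass (q (p m))) ≤
      ENNReal.ofReal (1 / (1 + (r : ℝ))) := by
    intro m
    refine edist_decorateClass_le Ψ h0 hAdj m _ (fun x => ?_) (fun x => ?_) fun x y h h' => ?_
    · rw [q2]
      simp [p, φ]
    · rw [q3]
      simp [p, φ]
    · refine (q1 (p m) (H.edge (x := Ψ x) (y := Ψ y) h')).trans ?_
      change m.1 (fE _) = _
      apply Subtype.ext
      simp [fE, LoopGraph.edge, φ]
  have d2 : ∀ m' : g'.graph.Marks, edist (g'.decorateClass (q (p' m'))) (g'.decorateClass m') ≤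
      ENNReal.ofReal (1 / (1 + (r : ℝ))) := by
    intro m'
    rw [edist_comm]
    exact edist_decorateClass_le (Equiv.refl _) (fun _ h => h) (fun _ _ => Iff.rfl) m' _
      (fun x => q2 (p' m') x) (fun x => q3 (p' m') x)
      fun x y h h' => q1 (p' m') (H.edge (x := x) (y := y) h)
  calc g.graph.iidMarks wgt med ini _
      ≤ g.graph.iidMarks wgt med ini (p ⁻¹' (q ⁻¹' (g'.decorateClass ⁻¹' A))) :=
        measure_mono fun m hm => by
          rw [Set.mem_ofPred_eq] at hm
          exact hm _ (d1 m)
    _ = g'.graph.iidMarks wgt med ini (p' ⁻¹' (q ⁻¹' (g'.decorateClass ⁻¹' A))) := by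
        rw [hp.measure_preimage hC.nullMeasurableSet, hp'.measure_preimage hC.nullMeasurableSet]
    _ ≤ _ := measure_mono fun m' hm' => by
        rw [Set.mem_ofPred_eq]
        exact ⟨_, hm', d2 m'⟩

/-- The law of the random rooted network `(N^G, o)` obtained from a rooted graph `(G, o)` by adding
independent marks, as a measure on rooted networks up to isomorphism. -/
def markLaw (wgt : ProbabilityMeasure (Set.Ioi (0 : ℝ))) (med ini : ProbabilityMeasure ℝ)
    (g : RootedGraph) : Measure DiffNetClass :=
  (g.graph.iidMarks wgt med ini).map g.decorateClass

instance (wgt : ProbabilityMeasure (Set.Ioi (0 : ℝ))) (med ini : ProbabilityMeasure ℝ)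
    (g : RootedGraph) : IsProbabilityMeasure (markLaw wgt med ini g) :=
  Measure.isProbabilityMeasure_map g.measurable_decorateClass.aemeasurable

variable (wgt : ProbabilityMeasure (Set.Ioi (0 : ℝ))) (med ini : ProbabilityMeasure ℝ)

theorem markLaw_le {g g' : RootedGraph} {r : ℕ} {δ₀ : ℝ} (h : Good g g' r δ₀)
    {A : Set DiffNetClass} (hA : IsOpen A) {c : ℝ≥0∞}
    (hc : ENNReal.ofReal (1 / (1 + (r : ℝ))) < c) :
    markLaw wgt med ini g {x | c + c ≤ Metric.infEDist x Aᶜ} ≤ markLaw wgt med ini g' A := by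
  have hcl : ∀ c : ℝ≥0∞, IsClosed {x : DiffNetClass | c ≤ Metric.infEDist x Aᶜ} := fun c =>
    isClosed_le continuous_const Metric.continuous_infEDist
  rw [markLaw, markLaw, Measure.map_apply g.measurable_decorateClass (hcl _).measurableSet,
    Measure.map_apply g'.measurable_decorateClass hA.measurableSet]
  refine le_trans (measure_mono ?_) ((iidMarks_transfer wgt med ini h (hcl c)).trans
    (measure_mono ?_))
  · intro m hm x hx
    by_contra hlt
    rw [Set.mem_ofPred_eq, not_le] at hlt
    have h1 : c + c ≤ Metric.infEDist (g.decorateClass m) Aᶜ := hm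
    have h2 : Metric.infEDist (g.decorateClass m) Aᶜ < c + c :=
      lt_of_le_of_lt Metric.infEDist_le_infEDist_add_edist
        (ENNReal.add_lt_add hlt (hx.trans_lt hc))
    exact absurd h1 (not_le.2 h2)
  · rintro m ⟨x, hx, hxm⟩
    by_contra hm
    have h1 : c ≤ Metric.infEDist x Aᶜ := hx
    have h2 : Metric.infEDist x Aᶜ ≤ edist x (g'.decorateClass m) :=
      Metric.infEDist_le_edist_of_mem hm
    exact absurd ((h1.trans h2).trans hxm) (not_le.2 hc)

theorem exists_lt_markLaw (g : RootedGraph) {A : Set DiffNetClass} (hA : IsOpen A) {b : ℝ≥0∞}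
    (hb : b < markLaw wgt med ini g A) :
    ∃ c : ℝ≥0∞, c ≠ 0 ∧ b < markLaw wgt med ini g {x | c + c ≤ Metric.infEDist x Aᶜ} := by
  let u : ℕ → ℝ≥0∞ := fun k => ((k : ℝ≥0∞) + 1)⁻¹
  have hu : ∀ k, u k ≠ 0 := fun k => by simp [u]
  have hu0 : Tendsto u atTop (𝓝 0) := by
    have := (ENNReal.tendsto_inv_nat_nhds_zero).comp (tendsto_add_atTop_nat 1)
    simpa [u, Function.comp_def] using this
  have hanti : Antitone u := fun k l hkl => by
    simp only [u]
    gcongr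
  have hmono : Monotone fun k => {x : DiffNetClass | u k + u k ≤ Metric.infEDist x Aᶜ} :=
    fun k l hkl x hx => (add_le_add (hanti hkl) (hanti hkl)).trans hx
  have hun : A ⊆ ⋃ k, {x : DiffNetClass | u k + u k ≤ Metric.infEDist x Aᶜ} := by
    intro x hx
    have hpos : 0 < Metric.infEDist x Aᶜ := by
      rw [Metric.infEDist_pos_iff_notMem_closure, hA.isClosed_compl.closure_eq]
      simpa using hx
    have h2 : Tendsto (fun k => u k + u k) atTop (𝓝 0) := by simpa using hu0.add hu0
    obtain ⟨k, hk⟩ := (h2.eventually_lt_const hpos).exists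
    exact Set.mem_iUnion.2 ⟨k, hk.le⟩
  have hlt := hb.trans_le (measure_mono hun)
  rw [hmono.measure_iUnion, lt_iSup_iff] at hlt
  obtain ⟨k, hk⟩ := hlt
  exact ⟨u k, hu k, hk⟩

theorem markLaw_le_of_iso {g g' : RootedGraph} (h : Iso g g') {A : Set DiffNetClass}
    (hA : IsOpen A) : markLaw wgt med ini g A ≤ markLaw wgt med ini g' A := by
  refine le_of_forall_lt fun b hb => ?_
  obtain ⟨c, hc, hbc⟩ := exists_lt_markLaw wgt med ini g hA hb
  obtain ⟨r, hr⟩ := exists_radius hc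
  exact hbc.trans_le (markLaw_le wgt med ini (h.good r one_pos) hA hr)

/-- The law of the marked network depends only on the isomorphism class of the rooted graph. -/
theorem markLaw_congr {g g' : RootedGraph} (h : Iso g g') :
    markLaw wgt med ini g = markLaw wgt med ini g' := by
  have h' : Iso g' g := Setoid.symm (α := RootedGraph) h
  refine ext_of_generate_finite _ (BorelSpace.measurable_eq (α := DiffNetClass)) isPiSystem_isOpen
    (fun A hA => ?_) (by simp)
  exact le_antisymm (markLaw_le_of_iso wgt med ini h hA) (markLaw_le_of_iso wgt med ini h' hA)

end RootedNetwork

/-- The mark kernel: it sends the class of a rooted graph `(G, o)` to the law of the random rooted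
network `(N^G, o)` carrying independent marks. -/
def markKernel (wgt : ProbabilityMeasure (Set.Ioi (0 : ℝ))) (med ini : ProbabilityMeasure ℝ) :
    Kernel GraphClass DiffNetClass where
  toFun := Quotient.lift (RootedNetwork.markLaw wgt med ini)
    fun _ _ h => RootedNetwork.markLaw_congr wgt med ini h
  measurable' := by
    have hprob : ∀ x : GraphClass, IsProbabilityMeasure (Quotient.lift
        (RootedNetwork.markLaw wgt med ini)
        (fun _ _ h => RootedNetwork.markLaw_congr wgt med ini h) x) :=
      fun x => Quotient.inductionOn x fun g =>
        inferInstanceAs (IsProbabilityMeasure (RootedNetwork.markLaw wgt med ini g))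
    refine Measurable.measure_of_isPiSystem_of_isProbabilityMeasure
      (BorelSpace.measurable_eq (α := DiffNetClass)) isPiSystem_isOpen fun A hA => ?_
    apply LowerSemicontinuous.measurable
    intro x b
    refine Quotient.inductionOn x fun g hb => ?_
    obtain ⟨c, hc, hbc⟩ := RootedNetwork.exists_lt_markLaw wgt med ini g hA hb
    filter_upwards [Metric.eball_mem_nhds (NetClass.mk g) (pos_iff_ne_zero.2 hc)] with y hy
    rw [Metric.mem_eball, edist_comm] at hy
    revert hy
    refine Quotient.inductionOn y fun g' hy => ?_
    obtain ⟨r, δ, ⟨hδ, hg⟩, hlt⟩ := RootedNetwork.localEDist_lt_iff.1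
      (show RootedNetwork.localEDist g g' < c from hy)
    refine hbc.trans_le (RootedNetwork.markLaw_le wgt med ini hg hA (lt_of_le_of_lt ?_ hlt))
    exact ENNReal.ofReal_le_ofReal (by linarith)

theorem markKernel_mk (wgt : ProbabilityMeasure (Set.Ioi (0 : ℝ)))
    (med ini : ProbabilityMeasure ℝ) (g : RootedGraph) : markKernel wgt med ini (NetClass.mk g) =
      (g.graph.iidMarks wgt med ini).map fun m => NetClass.mk (g.decorate m) := rfl

instance (wgt : ProbabilityMeasure (Set.Ioi (0 : ℝ))) (med ini : ProbabilityMeasure ℝ) :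
    IsMarkovKernel (markKernel wgt med ini) :=
  ⟨fun x => Quotient.inductionOn x fun g =>
    inferInstanceAs (IsProbabilityMeasure (RootedNetwork.markLaw wgt med ini g))⟩

/-- The mixture `ρM` of the laws `M(G, o)` when `(G, o)` has law `ρ`. -/
def markMixture (wgt : ProbabilityMeasure (Set.Ioi (0 : ℝ))) (med ini : ProbabilityMeasure ℝ)
    (ρ : ProbabilityMeasure GraphClass) : ProbabilityMeasure DiffNetClass :=
  ⟨(ρ : Measure GraphClass).bind (markKernel wgt med ini), inferInstance⟩

end

open scoped NNReal

noncomputable section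

/-! Weak convergence is tested on open sets: it suffices that almost surely, for every open `A`, the
liminf of `U(N_n)(A)` is at least `ρM(A)`. The local topology is second countable, so finite unions
of basic open sets approximate every open set from inside in measure. With rational levels, only
countably many almost sure statements are needed, each about one open set `B` and one `b < ρM(B)`.

For such `B` and `b` there are three inputs.

Mean. Restricting i.i.d. marks to a component gives i.i.d. marks, so the expectation of `U(N_n)` is
`U(G_n)M`. Rooted graphs with isomorphic `r`-balls have marked laws that can be coupled within
distance `1/(1+r)`, hence `x ↦ M(x)(A)` is lower semicontinuous for open `A`. The layer cake formula
and Fatou's lemma then give `ρM(A) ≤ liminf U(G_n)M(A)` (`markMixture_le_liminf`).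

Concentration. Resetting all marks outside the `r`-ball of `v` moves the class at `v` by at most
`1/(1+r)`. The proportion of vertices whose truncated class lies in a given set depends on each
single mark through at most `(D+1)^r` vertices, where `D` bounds the degrees. The bounded difference
inequality, over at most `n(D+2)` marks, bounds the lower tail by `exp(-s²n / (2(D+2)^(2r+1)))`
(`iidMarks_truncatedFrequency_le`).

Summability. As `D` is at most `n^ε_n` with `ε_n → 0`, each fixed power of `D+2` is eventually below
`√n`, so the tails are summable. The first Borel–Cantelli lemma applies, and it needs no assumption
on the dependence between different `n`.

Truncation errors are absorbed by shrinking `B` twice by a margin `c > 1/(1+r)`: once for the mean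
and once for the sample. -/

/-! ### Bounded differences -/

/-- The bounded difference inequality for `μ`, where `R i x y` says that `x` and `y` differ only in
the coordinate `i`. -/
def BoundedDifferencesInequality {α ι : Type*} [MeasurableSpace α] [Fintype ι] (μ : Measure α)
    (R : ι → α → α → Prop) : Prop :=
  ∀ (f : α → ℝ) (c : ι → ℝ≥0), Measurable f → (∃ M, ∀ x, |f x| ≤ M) →
    (∀ i x y, R i x y → |f x - f y| ≤ c i) →
    HasSubgaussianMGF (fun x => f x - ∫ y, f y ∂μ) (∑ i, c i ^ 2) μ

namespace BoundedDifferencesInequality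

variable {α β ι κ : Type*} [MeasurableSpace α] [MeasurableSpace β] [Fintype ι] [Fintype κ]
  {μ : Measure α} {ν : Measure β} {R : ι → α → α → Prop} {S : κ → β → β → Prop}

/-- With one coordinate, `f` stays within `c` of a reference value, so Hoeffding's lemma on an
interval of length `2c` gives variance proxy `c ^ 2`. This loses a factor 4 against the sharp
McDiarmid constant, which is immaterial here. -/
theorem of_unique [Unique ι] [IsProbabilityMeasure μ] (hR : ∀ x y, R default x y) :
    BoundedDifferencesInequality μ R := by
  intro f c hf _ hc
  obtain ⟨x₀⟩ := μ.nonempty_of_neZero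
  have h := hasSubgaussianMGF_of_mem_Icc (μ := μ) (X := f) (a := f x₀ - c default)
    (b := f x₀ + c default) hf.aemeasurable (ae_of_all _ fun x => by
      have := abs_le.1 (hc default x x₀ (hR x x₀))
      constructor <;> linarith [this.1, this.2])
  convert h using 1
  rw [Fintype.sum_unique]
  apply NNReal.eq
  have : f x₀ + c default - (f x₀ - c default) = 2 * c default := by ring
  simp [this]

theorem of_isEmpty [IsEmpty ι] [IsProbabilityMeasure μ] (hα : Subsingleton α) :
    BoundedDifferencesInequality μ R := by
  intro f c hf _ _
  obtain ⟨x₀⟩ := μ.nonempty_of_neZero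
  have hconst : f = fun _ => f x₀ := funext fun x => congrArg f (Subsingleton.elim _ _)
  have : (fun x => f x - ∫ y, f y ∂μ) = fun _ => 0 := by
    rw [hconst]
    simp
  rw [this]
  simp

theorem map {T : α → β} (hT : MeasurePreserving T μ ν) (e : κ ≃ ι)
    (hRS : ∀ i x y, R (e i) x y → S i (T x) (T y)) (h : BoundedDifferencesInequality μ R) :
    BoundedDifferencesInequality ν S := by
  intro f c hf ⟨M, hM⟩ hc
  have hg := h (f ∘ T) (c ∘ e.symm) (hf.comp hT.measurable) ⟨M, fun x => hM _⟩ fun i x y hxy =>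
    hc (e.symm i) _ _ (hRS _ _ _ (by simpa using hxy))
  have hint : ∫ x, (f ∘ T) x ∂μ = ∫ y, f y ∂ν := by
    rw [← hT.map_eq, integral_map hT.measurable.aemeasurable hf.aestronglyMeasurable]
    rfl
  have hsum : ∑ i, (c ∘ e.symm) i ^ 2 = ∑ i, c i ^ 2 := Equiv.sum_comp e.symm fun i => c i ^ 2
  rw [hint, hsum] at hg
  have hexp : ∀ t, Measurable fun y => Real.exp (t * (f y - ∫ z, f z ∂ν)) := by fun_prop
  refine ⟨fun t => ?_, fun t => ?_⟩
  · rw [← hT.integrable_comp (hexp t).aestronglyMeasurable]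
    exact hg.integrable_exp_mul t
  · rw [show mgf (fun y => f y - ∫ z, f z ∂ν) ν t = mgf (fun y => f y - ∫ z, f z ∂ν) (μ.map T) t by
      rw [hT.map_eq], mgf_map hT.measurable.aemeasurable (hexp t).aestronglyMeasurable]
    exact hg.mgf_le t

/-- Tensorisation: for fixed `a`, `f (a, ·)` is subgaussian around its mean `F a`, and `F` inherits
from `f` the bounded differences in the first factor. Integrating first in `b`, then in `a`,
multiplies the two bounds, so the proxies add. -/
theorem prod [IsProbabilityMeasure μ] [IsProbabilityMeasure ν]
    (hμ : BoundedDifferencesInequality μ R) (hν : BoundedDifferencesInequality ν S) :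
    BoundedDifferencesInequality (μ.prod ν) (Sum.elim
      (fun i p q => R i p.1 q.1 ∧ p.2 = q.2) (fun j p q => p.1 = q.1 ∧ S j p.2 q.2)) := by
  intro f c hf ⟨M, hM⟩ hc
  have hbint : ∀ a, Integrable (fun b => f (a, b)) ν := fun a =>
    Integrable.of_bound
      (hf.comp measurable_prodMk_left).aestronglyMeasurable M (ae_of_all _ fun b => hM (a, b))
  have hint : Integrable f (μ.prod ν) :=
    Integrable.of_bound hf.aestronglyMeasurable M (ae_of_all _ hM)
  let F : α → ℝ := fun a => ∫ b, f (a, b) ∂ν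
  have hFm : Measurable F := (hf.stronglyMeasurable.integral_prod_right').measurable
  have hF := hμ F (fun i => c (Sum.inl i)) hFm
    ⟨M, fun a => by
      simpa using norm_integral_le_of_norm_le_const (μ := ν) (f := fun b => f (a, b))
        (ae_of_all _ fun b => hM (a, b))⟩
    fun i a a' haa' => by
      have : F a - F a' = ∫ b, (f (a, b) - f (a', b)) ∂ν := (integral_sub (hbint a) (hbint a')).symm
      rw [this]
      simpa using norm_integral_le_of_norm_le_const (μ := ν)
        (f := fun b => f (a, b) - f (a', b)) (ae_of_all _ fun b => hc (Sum.inl i) (a, b) (a', b) ⟨haa', rfl⟩)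
  have hfa : ∀ a, HasSubgaussianMGF (fun b => f (a, b) - F a) (∑ j, c (Sum.inr j) ^ 2) ν := fun a =>
    hν (fun b => f (a, b)) (fun j => c (Sum.inr j)) (hf.comp measurable_prodMk_left)
      ⟨M, fun b => hM (a, b)⟩
      fun j b b' hbb' => hc (Sum.inr j) (a, b) (a, b') ⟨rfl, hbb'⟩
  have hmean : ∫ p, f p ∂(μ.prod ν) = ∫ a, F a ∂μ := integral_prod _ hint
  have hexp : ∀ t, Integrable (fun p => Real.exp (t * (f p - ∫ q, f q ∂(μ.prod ν)))) (μ.prod ν) :=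
    fun t => integrable_exp_mul_of_mem_Icc (a := -M - ∫ q, f q ∂(μ.prod ν))
      (b := M - ∫ q, f q ∂(μ.prod ν)) (by fun_prop) (ae_of_all _ fun p => by
        have := abs_le.1 (hM p)
        constructor <;> linarith [this.1, this.2])
  refine ⟨hexp, fun t => ?_⟩
  rw [mgf, integral_prod _ (hexp t), hmean]
  calc ∫ a, ∫ b, Real.exp (t * (f (a, b) - ∫ a, F a ∂μ)) ∂ν ∂μ
      ≤ ∫ a, Real.exp (t * (F a - ∫ a, F a ∂μ)) *
          Real.exp ((∑ j, c (Sum.inr j) ^ 2 : ℝ≥0) * t ^ 2 / 2) ∂μ := by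
        refine integral_mono_of_nonneg (ae_of_all _ fun a => by positivity)
          ((hF.integrable_exp_mul t).mul_const _) (ae_of_all _ fun a => ?_)
        have : ∀ b, Real.exp (t * (f (a, b) - ∫ a, F a ∂μ)) =
            Real.exp (t * (F a - ∫ a, F a ∂μ)) * Real.exp (t * (f (a, b) - F a)) := fun b => by
          rw [← Real.exp_add]
          ring_nf
        simp only [this]
        rw [integral_const_mul]
        gcongr
        exact (hfa a).mgf_le t
    _ ≤ Real.exp ((∑ i, c (Sum.inl i) ^ 2 : ℝ≥0) * t ^ 2 / 2) *
          Real.exp ((∑ j, c (Sum.inr j) ^ 2 : ℝ≥0) * t ^ 2 / 2) := by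
        rw [integral_mul_const]
        gcongr
        exact hF.mgf_le t
    _ = Real.exp ((∑ i, c i ^ 2 : ℝ≥0) * t ^ 2 / 2) := by
        rw [← Real.exp_add, Fintype.sum_sum_type]
        push_cast
        ring_nf

/-- Induction on the finite index type: adding an index is a product with one more copy of `p`,
itself a one-coordinate space. -/
theorem infinitePi {X : Type} [MeasurableSpace X] (p : Measure X) [IsProbabilityMeasure p]
    (ι : Type) [Fintype ι] : BoundedDifferencesInequality (Measure.infinitePi fun _ : ι => p)
      (fun i m m' => ∀ j, j ≠ i → m j = m' j) := by
  refine Fintype.induction_empty_option (P := fun ι _ => BoundedDifferencesInequality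
    (Measure.infinitePi fun _ : ι => p) (fun i m m' => ∀ j, j ≠ i → m j = m' j)) ?_ ?_ ?_ ι
  · intro α β _ e h
    let := Fintype.ofEquiv β e.symm
    exact h.map (map_comp_infinitePi p e.symm.injective) e.symm
      fun i x y hxy j hj => hxy _ fun h => hj (e.symm.injective h)
  · exact of_isEmpty inferInstance
  · intro α _ h
    have hT : MeasurePreserving (MeasurableEquiv.piOptionEquivProd fun _ : Option α => X).symm
        ((Measure.infinitePi fun _ : α => p).prod p) (Measure.infinitePi fun _ : Option α => p) := by
      rw [Measure.infinitePi_eq_pi, Measure.infinitePi_eq_pi]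
      exact ⟨MeasurableEquiv.measurable _, Measure.pi_map_piOptionEquivProd fun _ : Option α => p⟩
    have hone : BoundedDifferencesInequality p fun (_ : PUnit.{1}) (_ _ : X) => True :=
      of_unique fun _ _ => trivial
    refine (h.prod hone).map hT (Equiv.optionEquivSumPUnit.{0} α) ?_
    rintro (_ | i) ⟨x, x'⟩ ⟨y, y'⟩ hxy (_ | j) hj
    · exact absurd rfl hj
    · exact congrFun hxy.1 j
    · exact hxy.2
    · exact hxy.1 j fun h => hj (congrArg some h)

end BoundedDifferencesInequality

/-! ### Bounded differences for the marks of a graph -/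

namespace LoopGraph

variable {V : Type} (G : LoopGraph V)

/-- Two families of marks differ in at most one mark: an edge weight, a media variable or an initial
condition. -/
def MarksDifferAt : G.edgeSet ⊕ (V ⊕ V) → G.Marks → G.Marks → Prop :=
  Sum.elim (fun e p q => (∀ e', e' ≠ e → p.1 e' = q.1 e') ∧ p.2 = q.2)
    (fun j p q => p.1 = q.1 ∧ (Sum.elim
      (fun v (p q : (V → ℝ) × (V → ℝ)) => (∀ w, w ≠ v → p.1 w = q.1 w) ∧ p.2 = q.2)
      (fun v p q => p.1 = q.1 ∧ ∀ w, w ≠ v → p.2 w = q.2 w)) j p.2 q.2)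

/-- `MarksDifferAt` is nested exactly like the product defining `iidMarks`, so tensorising twice
yields it without reindexing. -/
theorem boundedDifferencesInequality_iidMarks [Fintype V] [Fintype G.edgeSet]
    (wgt : ProbabilityMeasure (Set.Ioi (0 : ℝ))) (med ini : ProbabilityMeasure ℝ) :
    BoundedDifferencesInequality (G.iidMarks wgt med ini) G.MarksDifferAt :=
  (BoundedDifferencesInequality.infinitePi _ G.edgeSet).prod
    ((BoundedDifferencesInequality.infinitePi _ V).prod
      (BoundedDifferencesInequality.infinitePi _ V))

end LoopGraph

/-! ### Separability of the local topology -/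

/-- The code of a point is the index of a term of a dense sequence within `δ / 2` of it. -/
theorem exists_code (α : Type*) [PseudoMetricSpace α] [TopologicalSpace.SeparableSpace α] {δ : ℝ}
    (hδ : 0 < δ) : ∃ code : α → ℕ, ∀ x y, code x = code y → dist x y < δ := by
  rcases isEmpty_or_nonempty α with h | h
  · exact ⟨fun _ => 0, fun x => h.elim x⟩
  have key : ∀ x : α, ∃ n, dist x (TopologicalSpace.denseSeq α n) < δ / 2 := fun x =>
    (TopologicalSpace.denseRange_denseSeq α).exists_dist_lt x (half_pos hδ)
  choose code hcode using key
  refine ⟨code, fun x y hxy => ?_⟩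
  have h1 := hcode x
  have h2 := hcode y
  rw [← hxy] at h2
  linarith [dist_triangle_right x y (TopologicalSpace.denseSeq α (code x))]

namespace RootedNetwork

variable {Υ Ξ : Type} [PseudoMetricSpace Υ] [PseudoMetricSpace Ξ]
  [TopologicalSpace.SeparableSpace Υ] [TopologicalSpace.SeparableSpace Ξ]

/-- Countably many labels suffice to determine the marked ball around the root up to `δ`. -/
theorem exists_ball_code (r : ℕ) {δ : ℝ} (hδ : 0 < δ) :
    ∃ code : RootedNetwork Υ Ξ →
        (k : ℕ) × (Fin k × (Fin k → Fin k → Option ℕ) × (Fin k → ℕ)),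
      ∀ N N', code N = code N' → Good N N' r δ := by
  classical
  obtain ⟨cv, hcv⟩ := exists_code Υ hδ
  obtain ⟨ce, hce⟩ := exists_code Ξ hδ
  have hball : ∀ N : RootedNetwork Υ Ξ, ∃ k : ℕ, Nonempty (Fin k ≃ N.ball r) := fun N => by
    have : Finite (N.ball r) := N.graph.ball_finite N.locallyFinite N.root r
    exact ⟨Nat.card (N.ball r), ⟨(Finite.equivFin _).symm⟩⟩
  choose k e using hball
  let e : ∀ N : RootedNetwork Υ Ξ, Fin (k N) ≃ N.ball r := fun N => (e N).some
  refine ⟨fun N => ⟨k N, (e N).symm ⟨N.root, N.root_mem_ball r⟩, fun i j =>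
    if h : N.graph.Adj (e N i) (e N j) then some (ce (N.net.emark (N.graph.edge h))) else none,
    fun i => cv (N.net.vmark (e N i))⟩, fun N N' h => ?_⟩
  -- The sizes and enumerations are generalised so that the equality of sizes can be substituted
  -- before the dependent components are compared.
  have transport : ∀ (k k' : ℕ) (e : Fin k ≃ N.ball r) (e' : Fin k' ≃ N'.ball r),
      (⟨k, e.symm ⟨N.root, N.root_mem_ball r⟩, fun i j =>
        if h : N.graph.Adj (e i) (e j) then some (ce (N.net.emark (N.graph.edge h))) else none,
        fun i => cv (N.net.vmark (e i))⟩ :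
          (k : ℕ) × (Fin k × (Fin k → Fin k → Option ℕ) × (Fin k → ℕ))) =
      ⟨k', e'.symm ⟨N'.root, N'.root_mem_ball r⟩, fun i j =>
        if h : N'.graph.Adj (e' i) (e' j) then some (ce (N'.net.emark (N'.graph.edge h))) else none,
        fun i => cv (N'.net.vmark (e' i))⟩ → Good N N' r δ := by
    intro k k' e e' h
    obtain rfl : k = k' := congrArg Sigma.fst h
    rw [Sigma.mk.injEq, heq_eq_eq, Prod.mk.injEq, Prod.mk.injEq] at h
    obtain ⟨-, h0, hE, hV⟩ := h
    have hE' : ∀ i j, (if h : N.graph.Adj (e i) (e j) then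
        some (ce (N.net.emark (N.graph.edge h))) else none) =
        if h : N'.graph.Adj (e' i) (e' j) then
          some (ce (N'.net.emark (N'.graph.edge h))) else none := fun i j => congrFun₂ hE i j
    have hval : ∀ x, e' (e.symm (e x)) = e' x := by simp
    refine ⟨e.symm.trans e', fun x hx => ?_, fun x y => ?_, fun x => ?_, fun x y h h' => ?_⟩
    · have : x = ⟨N.root, N.root_mem_ball r⟩ := Subtype.ext hx
      rw [this, Equiv.trans_apply, h0]
      simp
    · obtain ⟨i, rfl⟩ := e.surjective x
      obtain ⟨j, rfl⟩ := e.surjective y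
      have := hE' i j
      simp only [Equiv.trans_apply, Equiv.symm_apply_apply]
      by_cases h : N.graph.Adj (e i) (e j) <;> by_cases h' : N'.graph.Adj (e' i) (e' j) <;>
        simp [h, h'] at this ⊢
    · obtain ⟨i, rfl⟩ := e.surjective x
      refine hcv _ _ ?_
      simpa using congrFun hV i
    · obtain ⟨i, rfl⟩ := e.surjective x
      obtain ⟨j, rfl⟩ := e.surjective y
      refine hce _ _ ?_
      have := hE' i j
      simp only [Equiv.trans_apply, Equiv.symm_apply_apply] at h' ⊢
      rw [dif_pos h, dif_pos h'] at this
      exact Option.some.inj this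
  exact transport _ _ _ _ h

end RootedNetwork

/-- The codes form a countable type, so one representative of each code that occurs gives a
countable set that comes within any prescribed distance of every class. -/
instance {Υ Ξ : Type} [PseudoMetricSpace Υ] [PseudoMetricSpace Ξ]
    [TopologicalSpace.SeparableSpace Υ] [TopologicalSpace.SeparableSpace Ξ] :
    SecondCountableTopology (NetClass Υ Ξ) := by
  refine EMetric.secondCountable_of_almost_dense_set fun c hc => ?_
  obtain ⟨r, hr⟩ := RootedNetwork.exists_radius hc.ne'
  obtain ⟨δ, hδ0, hδ⟩ : ∃ δ : ℝ, 0 < δ ∧ ENNReal.ofReal (1 / (1 + (r : ℝ)) + δ) < c := by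
    have h1 : Tendsto (fun δ : ℝ => ENNReal.ofReal (1 / (1 + (r : ℝ)) + δ)) (𝓝[>] 0)
        (𝓝 (ENNReal.ofReal (1 / (1 + (r : ℝ)) + 0))) := by
      apply ENNReal.tendsto_ofReal
      exact (tendsto_const_nhds.add tendsto_id).mono_left nhdsWithin_le_nhds
    rw [add_zero] at h1
    obtain ⟨δ, h, h'⟩ := ((h1.eventually_lt_const hr).and self_mem_nhdsWithin).exists
    exact ⟨δ, h', h⟩
  obtain ⟨code, hcode⟩ := RootedNetwork.exists_ball_code (Υ := Υ) (Ξ := Ξ) r hδ0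
  choose rep hrep using fun y : Set.range code => Set.mem_range.1 y.2
  refine ⟨Set.range fun y => NetClass.mk (rep y), Set.countable_range _, ?_⟩
  refine Set.eq_univ_of_forall fun x => Quotient.inductionOn x fun N => ?_
  refine Set.mem_biUnion (Set.mem_range_self (⟨code N, Set.mem_range_self N⟩ : Set.range code)) ?_
  exact (RootedNetwork.localEDist_le (N := N) hδ0 (hcode _ _ (hrep ⟨code N, Set.mem_range_self N⟩).symm)).trans hδ.le

/-! ### Neighbourhoods in finite graphs -/

namespace LoopGraph

variable {V : Type} (G : LoopGraph V)

theorem mem_ball_comm {x y : V} {r : ℕ} : x ∈ G.ball y r ↔ y ∈ G.ball x r := by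
  change G.loopless.edist y x ≤ r ↔ G.loopless.edist x y ≤ r
  rw [SimpleGraph.edist_comm]

/-- Each step adds at most `D` neighbours per vertex of the ball, so its size grows at most by the
factor `D + 1`. -/
theorem ncard_ball_le [Finite V] {D : ℕ} (hD : ∀ x, G.degree x ≤ D) (o : V) (r : ℕ) :
    (G.ball o r).ncard ≤ (D + 1) ^ r := by
  classical
  have := Fintype.ofFinite V
  induction r with
  | zero =>
    have : G.ball o 0 = {o} := Set.ext fun x => G.mem_ball_zero
    simp [this]
  | succ r ih =>
    have hsub : G.ball o (r + 1) ⊆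
        G.ball o r ∪ ⋃ y ∈ (G.ball o r).toFinset, {x | G.Adj x y} := fun x hx => by
      rcases G.mem_ball_succ.1 hx with h | ⟨y, hy, hyx⟩
      · exact Or.inl h
      · exact Or.inr (Set.mem_biUnion (by simpa using hy) (G.symm hyx))
    calc (G.ball o (r + 1)).ncard
        ≤ (G.ball o r).ncard + (⋃ y ∈ (G.ball o r).toFinset, {x | G.Adj x y}).ncard :=
          (Set.ncard_le_ncard hsub (Set.toFinite _)).trans (Set.ncard_union_le _ _)
      _ ≤ (G.ball o r).ncard + ∑ y ∈ (G.ball o r).toFinset, G.degree y := by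
          gcongr
          exact Finset.set_ncard_biUnion_le _ _
      _ ≤ (G.ball o r).ncard + ∑ y ∈ (G.ball o r).toFinset, D := by
          gcongr with y
          exact hD y
      _ = (G.ball o r).ncard * (D + 1) := by
          rw [Finset.sum_const, smul_eq_mul, ← Set.ncard_eq_toFinset_card']
          ring
      _ ≤ (D + 1) ^ (r + 1) := by
          rw [pow_succ]
          gcongr

theorem card_edgeSet_le [Finite V] {D : ℕ} (hD : ∀ x, G.degree x ≤ D) :
    Nat.card G.edgeSet ≤ Nat.card V * D := by
  have := Fintype.ofFinite V
  let f : (Σ x : V, {y | G.Adj y x}) → G.edgeSet := fun p => G.edge p.2.2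
  have hf : Function.Surjective f := by
    rintro ⟨e, x, y, rfl, h⟩
    exact ⟨⟨y, x, h⟩, rfl⟩
  calc Nat.card G.edgeSet ≤ Nat.card (Σ x : V, {y | G.Adj y x}) := Nat.card_le_card_of_surjective f hf
    _ = ∑ x : V, G.degree x := Nat.card_sigma
    _ ≤ ∑ _x : V, D := Finset.sum_le_sum fun x _ => hD x
    _ = Nat.card V * D := by simp

/-! ### Marked neighbourhoods -/

section Neighbourhood

variable [Finite V]

/-- The class of the component of `v`, rooted at `v`, in the network with marks `m`. -/
def markedClass (v : V) (m : G.Marks) : DiffNetClass := NetClass.mk ((G.decorate m).componentAt v)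

/-- The restriction of marks to the component of `v`. -/
def componentMarks (v : V) (m : G.Marks) : (G.bare.componentAt v).graph.Marks :=
  (fun e => m.1 ⟨e.1.map Subtype.val, G.map_mem_edgeSet _ e.2⟩, fun x => m.2.1 x.1,
    fun x => m.2.2 x.1)

theorem markedClass_eq (v : V) (m : G.Marks) :
    G.markedClass v m = (G.bare.componentAt v).decorateClass (G.componentMarks v m) := rfl

theorem measurePreserving_componentMarks (wgt : ProbabilityMeasure (Set.Ioi (0 : ℝ)))
    (med ini : ProbabilityMeasure ℝ) (v : V) :
    MeasurePreserving (G.componentMarks v) (G.iidMarks wgt med ini)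
      ((G.bare.componentAt v).graph.iidMarks wgt med ini) := by
  let f : (G.bare.componentAt v).graph.edgeSet → G.edgeSet :=
    fun e => ⟨e.1.map Subtype.val, G.map_mem_edgeSet _ e.2⟩
  have hf : Function.Injective f := fun a b hab =>
    Subtype.ext (Sym2.map.injective Subtype.val_injective (congrArg Subtype.val hab))
  exact (map_comp_infinitePi _ hf).prod
    ((map_comp_infinitePi _ Subtype.val_injective).prod
      (map_comp_infinitePi _ Subtype.val_injective))

theorem measurable_markedClass (v : V) : Measurable (G.markedClass v) :=
  (G.bare.componentAt v).measurable_decorateClass.comp (g := (G.bare.componentAt v).decorateClass)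
    (f := G.componentMarks v) (by unfold componentMarks; fun_prop)

/-- Restricting i.i.d. families along injections keeps them i.i.d., so the marks seen from `v` are
those the kernel would assign to its component. -/
theorem map_markedClass (wgt : ProbabilityMeasure (Set.Ioi (0 : ℝ)))
    (med ini : ProbabilityMeasure ℝ) (v : V) :
    (G.iidMarks wgt med ini).map (G.markedClass v) =
      markKernel wgt med ini (NetClass.mk (G.bare.componentAt v)) := by
  have h := G.measurePreserving_componentMarks wgt med ini v
  rw [markKernel_mk, ← h.map_eq]
  exact (Measure.map_map (G.bare.componentAt v).measurable_decorateClass h.measurable).symm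

theorem mem_ball_of_mem_ball_componentAt (v : V) {r : ℕ} (x : (G.bare.componentAt v).V)
    (hx : x ∈ (G.bare.componentAt v).ball r) : x.1 ∈ G.ball v r := by
  induction r generalizing x with
  | zero =>
    rw [LoopGraph.mem_ball_zero] at hx
    rw [hx, mem_ball_zero]
    rfl
  | succ r ih =>
    rcases (LoopGraph.mem_ball_succ _).1 hx with h | ⟨y, hy, hyx⟩
    · exact G.mem_ball_succ.2 (Or.inl (ih x h))
    · exact G.mem_ball_succ.2 (Or.inr ⟨y.1, ih y hy, hyx⟩)

end Neighbourhood

/-! ### Truncation of the marks to a ball -/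

open Classical in
/-- Replacing all marks outside the `r`-ball around `v` by default values. -/
def truncate (v : V) (r : ℕ) (m : G.Marks) : G.Marks :=
  (fun e => if ∀ x ∈ e.1, x ∈ G.ball v r then m.1 e else ⟨1, Set.mem_Ioi.2 one_pos⟩,
    fun x => if x ∈ G.ball v r then m.2.1 x else 0,
    fun x => if x ∈ G.ball v r then m.2.2 x else 0)

theorem measurable_truncate (v : V) (r : ℕ) : Measurable (G.truncate v r) := by
  classical
  refine Measurable.prodMk (measurable_pi_lambda _ fun e => ?_)
    (Measurable.prodMk (measurable_pi_lambda _ fun x => ?_) (measurable_pi_lambda _ fun x => ?_)) <;>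
  · split_ifs <;> fun_prop

/-- The `r`-ball of the component lies in the `r`-ball of `G`, where truncation changes nothing;
hence the identity matches all marks exactly there. -/
theorem edist_markedClass_truncate_le [Finite V] (v : V) (r : ℕ) (m : G.Marks) :
    edist (G.markedClass v m) (G.markedClass v (G.truncate v r m)) ≤
      ENNReal.ofReal (1 / (1 + (r : ℝ))) := by
  rw [markedClass_eq, markedClass_eq]
  have hball := fun x => G.mem_ball_of_mem_ball_componentAt v (r := r) x
  refine RootedNetwork.edist_decorateClass_le (Equiv.refl _) (fun _ h => h) (fun _ _ => Iff.rfl) _ _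
    (fun x => if_pos (hball _ x.2)) (fun x => if_pos (hball _ x.2)) fun x y h h' => if_pos ?_
  intro z hz
  rcases Sym2.mem_iff.1 hz with rfl | rfl
  · exact hball _ x.2
  · exact hball _ y.2

/-- An end of the edge, or the vertex, that carries a given mark. -/
def markAnchor : G.edgeSet ⊕ (V ⊕ V) → V := Sum.elim (fun e => e.1.out.1) (Sum.elim id id)

/-- The arbitrary choice of an end in `markAnchor` is harmless, because an edge weight survives
truncation only if both ends lie in the ball. -/
theorem truncate_eq_of_marksDifferAt {v : V} {r : ℕ} {i : G.edgeSet ⊕ (V ⊕ V)} {p q : G.Marks}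
    (h : G.MarksDifferAt i p q) (hi : G.markAnchor i ∉ G.ball v r) :
    G.truncate v r p = G.truncate v r q := by
  classical
  have key : ∀ {X : Type} (f g : V → X) (w : V) (d : X), (∀ x, x ≠ w → f x = g x) →
      w ∉ G.ball v r → (fun x => if x ∈ G.ball v r then f x else d) =
        fun x => if x ∈ G.ball v r then g x else d := by
    intro X f g w d hfg hw
    funext x
    split_ifs with hx
    · exact hfg x fun hxw => hw (hxw ▸ hx)
    · rfl
  obtain ⟨p1, p2, p3⟩ := p
  obtain ⟨q1, q2, q3⟩ := q
  rcases i with e | w | w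
  · obtain ⟨h1, h2⟩ := h
    obtain ⟨rfl, rfl⟩ := Prod.mk.inj h2
    refine Prod.ext (funext fun e' => ?_) rfl
    change (if _ then _ else _) = if _ then _ else _
    split_ifs with he
    · refine h1 e' fun hee => hi ?_
      rw [hee] at he
      exact he _ (Sym2.out_fst_mem _)
    · rfl
  · obtain ⟨rfl, h1, rfl⟩ := h
    exact Prod.ext rfl (Prod.ext (key _ _ w _ h1 hi) rfl)
  · obtain ⟨rfl, rfl, h1⟩ := h
    exact Prod.ext rfl (Prod.ext rfl (key _ _ w _ h1 hi))

end LoopGraph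

/-! ### Empirical measures as averages over the vertices -/

theorem Network.empirical_real {V Υ Ξ : Type} [Fintype V] [Nonempty V] [PseudoMetricSpace Υ]
    [PseudoMetricSpace Ξ] (N : Network V Υ Ξ) {A : Set (NetClass Υ Ξ)} (hA : MeasurableSet A) :
    (N.empirical : Measure (NetClass Υ Ξ)).real A =
      (Fintype.card V : ℝ)⁻¹ * ∑ v, A.indicator 1 (NetClass.mk (N.componentAt v)) := by
  change ((Fintype.card V : ℝ≥0∞)⁻¹ •
    ∑ v : V, Measure.dirac (NetClass.mk (N.componentAt v))).real A = _
  rw [measureReal_ennreal_smul_apply, measureReal_def, Measure.finsetSum_apply,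
    ENNReal.toReal_sum (by simp)]
  simp only [Measure.dirac_apply' _ hA, ENNReal.toReal_inv, ENNReal.toReal_natCast]
  congr 1
  refine Finset.sum_congr rfl fun v _ => ?_
  by_cases h : NetClass.mk (N.componentAt v) ∈ A <;> simp [h]

theorem markMixture_empirical_real {V : Type} [Fintype V] [Nonempty V] (N : Network V Unit Unit)
    (wgt : ProbabilityMeasure (Set.Ioi (0 : ℝ))) (med ini : ProbabilityMeasure ℝ)
    {A : Set DiffNetClass} (hA : MeasurableSet A) :
    ((markMixture wgt med ini N.empirical : ProbabilityMeasure DiffNetClass) :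
        Measure DiffNetClass).real A =
      (Fintype.card V : ℝ)⁻¹ *
        ∑ v, (markKernel wgt med ini (NetClass.mk (N.componentAt v))).real A := by
  change (((Fintype.card V : ℝ≥0∞)⁻¹ • ∑ v : V, Measure.dirac (NetClass.mk (N.componentAt v))).bind
    (markKernel wgt med ini)).real A = _
  rw [measureReal_def, Measure.bind_apply hA (Kernel.aemeasurable _), lintegral_smul_measure,
    lintegral_finsetSum_measure, smul_eq_mul, ENNReal.toReal_mul, ENNReal.toReal_sum]
  · simp only [lintegral_dirac' _ (Kernel.measurable_coe _ hA), ENNReal.toReal_inv,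
      ENNReal.toReal_natCast, measureReal_def]
  · simp only [lintegral_dirac' _ (Kernel.measurable_coe _ hA)]
    exact fun _ _ => measure_ne_top _ _

/-! ### Concentration of truncated frequencies -/

namespace LoopGraph

variable {V : Type} (G : LoopGraph V) [Fintype V]

/-- The proportion of vertices whose neighbourhood, with marks truncated beyond distance `r`, has
its class in `C`. -/
def truncatedFrequency (r : ℕ) (C : Set DiffNetClass) (m : G.Marks) : ℝ :=
  (Fintype.card V : ℝ)⁻¹ * ∑ v, C.indicator 1 (G.markedClass v (G.truncate v r m))

theorem measurable_truncatedFrequency (r : ℕ) {C : Set DiffNetClass} (hC : MeasurableSet C) :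
    Measurable (G.truncatedFrequency r C) := by
  refine Measurable.const_mul (Finset.measurable_sum _ fun v _ => ?_) _
  exact (measurable_one.indicator hC).comp
    ((G.measurable_markedClass v).comp (G.measurable_truncate v r))

theorem abs_truncatedFrequency_le (r : ℕ) (C : Set DiffNetClass) (m : G.Marks) :
    |G.truncatedFrequency r C m| ≤ 1 := by
  have h : ∀ v, |C.indicator (1 : DiffNetClass → ℝ) (G.markedClass v (G.truncate v r m))| ≤ 1 :=
    fun v => by
      by_cases hv : G.markedClass v (G.truncate v r m) ∈ C <;> simp [hv]
  rw [truncatedFrequency, abs_mul, abs_of_nonneg (by positivity)]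
  calc _ ≤ (Fintype.card V : ℝ)⁻¹ * ∑ _v : V, (1 : ℝ) := by
        gcongr
        exact (Finset.abs_sum_le_sum_abs _ _).trans (Finset.sum_le_sum fun v _ => h v)
    _ ≤ 1 := by
        simpa using inv_mul_le_one (a := (Fintype.card V : ℝ))

theorem abs_truncatedFrequency_sub_le {r D : ℕ} (hD : ∀ x, G.degree x ≤ D) (C : Set DiffNetClass)
    {i : G.edgeSet ⊕ (V ⊕ V)} {p q : G.Marks} (h : G.MarksDifferAt i p q) :
    |G.truncatedFrequency r C p - G.truncatedFrequency r C q| ≤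
      (Fintype.card V : ℝ)⁻¹ * (D + 1) ^ r := by
  classical
  rw [truncatedFrequency, truncatedFrequency, ← mul_sub, ← Finset.sum_sub_distrib, abs_mul,
    abs_of_nonneg (by positivity)]
  gcongr
  calc _ ≤ ∑ v, |C.indicator (1 : DiffNetClass → ℝ) (G.markedClass v (G.truncate v r p)) -
          C.indicator 1 (G.markedClass v (G.truncate v r q))| := Finset.abs_sum_le_sum_abs _ _
    -- Only vertices within `r` of the anchor can see the altered mark; each contributes at most 1.
    _ ≤ ∑ v, if v ∈ G.ball (G.markAnchor i) r then (1 : ℝ) else 0 := by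
        refine Finset.sum_le_sum fun v _ => ?_
        split_ifs with hv
        · by_cases hp : G.markedClass v (G.truncate v r p) ∈ C <;>
          by_cases hq : G.markedClass v (G.truncate v r q) ∈ C <;> simp [hp, hq]
        · rw [G.truncate_eq_of_marksDifferAt h fun h' => hv (G.mem_ball_comm.1 h')]
          simp
    _ = ((G.ball (G.markAnchor i) r).ncard : ℝ) := by
        rw [Finset.sum_boole, Set.ncard_eq_toFinset_card']
        congr 2
        ext
        simp
    _ ≤ (D + 1) ^ r := by exact_mod_cast G.ncard_ball_le hD _ _

variable (wgt : ProbabilityMeasure (Set.Ioi (0 : ℝ))) (med ini : ProbabilityMeasure ℝ)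

/-- Concentration of the truncated frequencies in terms of a bound for the degrees. -/
theorem iidMarks_truncatedFrequency_le [Nonempty V] {r D : ℕ} (hD : ∀ x, G.degree x ≤ D)
    {C : Set DiffNetClass} (hC : MeasurableSet C) {s : ℝ} (hs : 0 ≤ s) :
    (G.iidMarks wgt med ini).real {m | G.truncatedFrequency r C m ≤
        ∫ m', G.truncatedFrequency r C m' ∂(G.iidMarks wgt med ini) - s} ≤
      Real.exp (-s ^ 2 * Fintype.card V / (2 * (D + 2) ^ (2 * r + 1))) := by
  have := Fintype.ofFinite G.edgeSet
  set n : ℝ := (Fintype.card V : ℝ) with hn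
  have hn0 : 0 < n := by simp [hn, Fintype.card_pos]
  let c : ℝ≥0 := ⟨n⁻¹ * (D + 1) ^ r, by positivity⟩
  have h := (G.boundedDifferencesInequality_iidMarks wgt med ini (G.truncatedFrequency r C)
    (fun _ => c) (G.measurable_truncatedFrequency r hC)
    ⟨1, G.abs_truncatedFrequency_le r C⟩
    fun i x y hxy => G.abs_truncatedFrequency_sub_le hD C hxy).neg.measure_ge_le hs
  have hset : {m | G.truncatedFrequency r C m ≤
      ∫ m', G.truncatedFrequency r C m' ∂(G.iidMarks wgt med ini) - s} =
      {m | s ≤ (-fun x => G.truncatedFrequency r C x -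
        ∫ m', G.truncatedFrequency r C m' ∂(G.iidMarks wgt med ini)) m} := by
    ext m
    simp only [Set.mem_ofPred_eq, Pi.neg_apply]
    constructor <;> intro h <;> linarith
  rw [hset]
  refine h.trans (Real.exp_le_exp.2 ?_)
  rcases hs.eq_or_lt with rfl | hs
  · simp
  -- At most `n * D` edge weights, plus `n` media variables and `n` initial conditions.
  have hcard : (Fintype.card (G.edgeSet ⊕ (V ⊕ V)) : ℝ) ≤ n * (D + 2) := by
    have h1 := G.card_edgeSet_le hD
    rw [Nat.card_eq_fintype_card, Nat.card_eq_fintype_card] at h1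
    have h2 : (Fintype.card G.edgeSet : ℝ) ≤ n * D := by
      rw [hn]
      exact_mod_cast h1
    rw [Fintype.card_sum, Fintype.card_sum]
    push_cast
    linarith
  have hpos : 0 < Fintype.card (G.edgeSet ⊕ (V ⊕ V)) := by
    have := Fintype.card_pos (α := V)
    rw [Fintype.card_sum, Fintype.card_sum]
    omega
  have hsum : ((∑ _i : G.edgeSet ⊕ (V ⊕ V), c ^ 2 : ℝ≥0) : ℝ) ≤
      (D + 2) ^ (2 * r + 1) / n := by
    have hc : (c : ℝ) = n⁻¹ * (D + 1) ^ r := rfl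
    rw [Finset.sum_const, Finset.card_univ, nsmul_eq_mul]
    push_cast
    rw [hc]
    -- Enlarging `D + 1` to `D + 2` merges the number of marks and the squared differences into one
    -- power.
    calc _ ≤ n * (D + 2) * (n⁻¹ * (D + 2) ^ r) ^ 2 := by gcongr; norm_num
      _ = _ := by
        field_simp
        ring
  -- Positivity is needed to compare the exponents: the sum stands in a denominator, and division by
  -- zero would give 0.
  have hsum0 : (0 : ℝ) < (∑ _i : G.edgeSet ⊕ (V ⊕ V), c ^ 2 : ℝ≥0) := by
    have hc : 0 < c := by
      rw [← NNReal.coe_pos]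
      change 0 < n⁻¹ * ((D : ℝ) + 1) ^ r
      positivity
    rw [Finset.sum_const, Finset.card_univ, nsmul_eq_mul]
    positivity
  rw [neg_mul, neg_div, neg_div, neg_le_neg_iff]
  calc s ^ 2 * n / (2 * (D + 2) ^ (2 * r + 1)) = s ^ 2 / (2 * ((D + 2) ^ (2 * r + 1) / n)) := by
        field_simp
    _ ≤ _ := by gcongr

variable {r : ℕ} {c : ℝ≥0∞} {B : Set DiffNetClass}

/-- First use of the margin: if the truncated class is at distance at least `c` from `Bᶜ`, the true
class, less than `c` away, is in `B`. -/
theorem truncatedFrequency_le_empirical [Nonempty V] (hr : ENNReal.ofReal (1 / (1 + (r : ℝ))) < c)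
    (hB : MeasurableSet B) (m : G.Marks) :
    G.truncatedFrequency r {x | c ≤ Metric.infEDist x Bᶜ} m ≤
      ((G.decorate m).empirical : Measure DiffNetClass).real B := by
  rw [Network.empirical_real _ hB, truncatedFrequency]
  gcongr with v
  change _ ≤ B.indicator 1 (G.markedClass v m)
  by_cases h : G.markedClass v m ∈ B
  · rw [Set.indicator_of_mem h]
    exact Set.indicator_le_self' (fun _ _ => zero_le_one) _
  · rw [Set.indicator_of_notMem h, Set.indicator_of_notMem]
    intro hc
    have h1 : Metric.infEDist (G.markedClass v (G.truncate v r m)) Bᶜ ≤ _ :=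
      Metric.infEDist_le_edist_of_mem h
    rw [edist_comm] at h1
    exact absurd ((le_trans hc h1).trans (G.edist_markedClass_truncate_le v r m)) (not_le.2 hr)

/-- Second use of the margin: a class farther than `c + c` from `Bᶜ` stays at distance at least `c`
after truncation. The left side is the expected empirical measure, and its set is open, as the limit
of the means requires. -/
theorem empirical_markKernel_le_integral [Nonempty V]
    (hr : ENNReal.ofReal (1 / (1 + (r : ℝ))) < c) :
    ((markMixture wgt med ini G.bare.empirical : ProbabilityMeasure DiffNetClass) :
        Measure DiffNetClass).real {x | c + c < Metric.infEDist x Bᶜ} ≤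
      ∫ m, G.truncatedFrequency r {x | c ≤ Metric.infEDist x Bᶜ} m ∂(G.iidMarks wgt med ini) := by
  have hA : MeasurableSet {x : DiffNetClass | c + c < Metric.infEDist x Bᶜ} :=
    (isOpen_lt continuous_const Metric.continuous_infEDist).measurableSet
  have hC : MeasurableSet {x : DiffNetClass | c ≤ Metric.infEDist x Bᶜ} :=
    (isClosed_le continuous_const Metric.continuous_infEDist).measurableSet
  have hT : ∀ v, Measurable fun m => G.markedClass v (G.truncate v r m) := fun v =>
    (G.measurable_markedClass v).comp (G.measurable_truncate v r)
  have hR : ∀ v, ∫ m, {x : DiffNetClass | c ≤ Metric.infEDist x Bᶜ}.indicator (1 : DiffNetClass → ℝ)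
      (G.markedClass v (G.truncate v r m)) ∂(G.iidMarks wgt med ini) =
      (G.iidMarks wgt med ini).real ((fun m => G.markedClass v (G.truncate v r m)) ⁻¹'
        {x : DiffNetClass | c ≤ Metric.infEDist x Bᶜ}) := fun v => by
    rw [← integral_indicator_one (hT v hC)]
    rfl
  simp only [truncatedFrequency]
  rw [integral_const_mul, integral_finsetSum _ fun v _ => ?_]
  · simp only [hR]
    rw [markMixture_empirical_real _ _ _ _ hA]
    gcongr with v
    rw [← G.map_markedClass, map_measureReal_apply (G.measurable_markedClass v) hA]
    refine measureReal_mono fun m hm => ?_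
    have hm : c + c < Metric.infEDist (G.markedClass v m) Bᶜ := hm
    change c ≤ Metric.infEDist (G.markedClass v (G.truncate v r m)) Bᶜ
    by_contra hlt
    exact absurd (hm.trans_le Metric.infEDist_le_infEDist_add_edist) (not_lt.2 (add_le_add
      (not_le.1 hlt).le ((G.edist_markedClass_truncate_le v r m).trans hr.le)))
  · exact (integrable_indicator_iff (hT v hC)).2 (integrable_const (1 : ℝ)).integrableOn

end LoopGraph

/-! ### Lower semicontinuous functions and weak convergence -/

/-- The layer cake formula writes the integral through the open sets `{t < f}`; Fatou's lemma in `t`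
moves the liminf outside. -/
theorem lintegral_le_liminf_lintegral_of_lowerSemicontinuous {α ι : Type*} [TopologicalSpace α]
    [MeasurableSpace α] [OpensMeasurableSpace α] {L : Filter ι} [L.IsCountablyGenerated]
    {μ : Measure α} {μs : ι → Measure α} {f : α → ℝ} (hf : LowerSemicontinuous f) (hf0 : 0 ≤ f)
    (h : ∀ A, IsOpen A → μ A ≤ liminf (fun i => μs i A) L) :
    ∫⁻ x, ENNReal.ofReal (f x) ∂μ ≤ liminf (fun i => ∫⁻ x, ENNReal.ofReal (f x) ∂(μs i)) L := by
  simp_rw [lintegral_eq_lintegral_meas_lt _ (Eventually.of_forall hf0) hf.measurable.aemeasurable]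
  calc ∫⁻ t in Set.Ioi (0 : ℝ), μ {a | t < f a}
      ≤ ∫⁻ t in Set.Ioi (0 : ℝ), liminf (fun i => μs i {a | t < f a}) L :=
        lintegral_mono fun t => h _ (hf.isOpen_preimage t)
    _ ≤ liminf (fun i => ∫⁻ t in Set.Ioi (0 : ℝ), μs i {a | t < f a}) L :=
        lintegral_liminf_le fun i => Antitone.measurable fun s t hst =>
          measure_mono fun a ha => lt_of_le_of_lt hst ha

section Kernel

variable (wgt : ProbabilityMeasure (Set.Ioi (0 : ℝ))) (med ini : ProbabilityMeasure ℝ)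

/-- A rooted graph closer than `c` shares an `r`-ball with `1/(1+r) < c`. Transferring marks along
it costs less than the margin `c + c` kept inside `A`. -/
theorem lowerSemicontinuous_markKernel {A : Set DiffNetClass} (hA : IsOpen A) :
    LowerSemicontinuous fun x => markKernel wgt med ini x A := by
  intro x b
  refine Quotient.inductionOn x fun g hb => ?_
  obtain ⟨c, hc, hbc⟩ := RootedNetwork.exists_lt_markLaw wgt med ini g hA hb
  filter_upwards [Metric.eball_mem_nhds (NetClass.mk g) (pos_iff_ne_zero.2 hc)] with y hy
  rw [Metric.mem_eball, edist_comm] at hy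
  revert hy
  refine Quotient.inductionOn y fun g' hy => ?_
  obtain ⟨r, δ, ⟨hδ, hg⟩, hlt⟩ := RootedNetwork.localEDist_lt_iff.1
    (show RootedNetwork.localEDist g g' < c from hy)
  refine hbc.trans_le (RootedNetwork.markLaw_le wgt med ini hg hA (lt_of_le_of_lt ?_ hlt))
  exact ENNReal.ofReal_le_ofReal (by linarith)

theorem markMixture_apply (ρ : ProbabilityMeasure GraphClass) {A : Set DiffNetClass}
    (hA : MeasurableSet A) : (markMixture wgt med ini ρ : Measure DiffNetClass) A =
      ∫⁻ x, ENNReal.ofReal ((markKernel wgt med ini x).real A) ∂(ρ : Measure GraphClass) := by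
  change ((ρ : Measure GraphClass).bind (markKernel wgt med ini)) A = _
  rw [Measure.bind_apply hA (Kernel.aemeasurable _)]
  exact lintegral_congr fun x => (ofReal_measureReal (measure_ne_top _ _)).symm

theorem markMixture_le_liminf {ι : Type*} {L : Filter ι} [L.IsCountablyGenerated]
    {ρs : ι → ProbabilityMeasure GraphClass} {ρ : ProbabilityMeasure GraphClass}
    (hρ : Tendsto ρs L (𝓝 ρ)) {A : Set DiffNetClass} (hA : IsOpen A) :
    (markMixture wgt med ini ρ : Measure DiffNetClass) A ≤
      liminf (fun i => (markMixture wgt med ini (ρs i) : Measure DiffNetClass) A) L := by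
  simp only [markMixture_apply _ _ _ _ hA.measurableSet]
  refine lintegral_le_liminf_lintegral_of_lowerSemicontinuous (fun x b hb => ?_)
    (fun x => measureReal_nonneg)
    fun A hA => ProbabilityMeasure.le_liminf_measure_open_of_tendsto hρ hA
  -- Negative levels are separated because `ENNReal.ofReal` collapses them to 0.
  rcases lt_or_ge b 0 with hb0 | hb0
  · exact Eventually.of_forall fun y => hb0.trans_le measureReal_nonneg
  · have h : ENNReal.ofReal b < markKernel wgt med ini x A :=
      (ENNReal.ofReal_lt_iff_lt_toReal hb0 (measure_ne_top _ _)).2 hb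
    filter_upwards [lowerSemicontinuous_markKernel wgt med ini hA x _ h] with y hy
    exact (ENNReal.ofReal_lt_iff_lt_toReal hb0 (measure_ne_top _ _)).1 hy

end Kernel

/-! ### Approximation of open sets -/

/-- An open set is the increasing union of the sets of points at distance more than `2/(k+1)` from
its complement. -/
theorem exists_lt_measure_infEDist {α : Type*} [PseudoEMetricSpace α] [MeasurableSpace α]
    (μ : Measure α) {A : Set α} (hA : IsOpen A) {b : ℝ≥0∞} (hb : b < μ A) :
    ∃ c : ℝ≥0∞, c ≠ 0 ∧ b < μ {x | c + c < Metric.infEDist x Aᶜ} := by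
  let u : ℕ → ℝ≥0∞ := fun k => ((k : ℝ≥0∞) + 1)⁻¹
  have hu0 : Tendsto u atTop (𝓝 0) := by
    have := (ENNReal.tendsto_inv_nat_nhds_zero).comp (tendsto_add_atTop_nat 1)
    simpa [u, Function.comp_def] using this
  have hanti : Antitone u := fun k l hkl => by
    simp only [u]
    gcongr
  have hmono : Monotone fun k => {x : α | u k + u k < Metric.infEDist x Aᶜ} :=
    fun k l hkl x hx => (add_le_add (hanti hkl) (hanti hkl)).trans_lt hx
  have hun : A ⊆ ⋃ k, {x : α | u k + u k < Metric.infEDist x Aᶜ} := by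
    intro x hx
    have hpos : 0 < Metric.infEDist x Aᶜ := by
      rw [Metric.infEDist_pos_iff_notMem_closure, hA.isClosed_compl.closure_eq]
      simpa using hx
    have h2 : Tendsto (fun k => u k + u k) atTop (𝓝 0) := by simpa using hu0.add hu0
    exact Set.mem_iUnion.2 (h2.eventually_lt_const hpos).exists
  have hlt := hb.trans_le (measure_mono hun)
  rw [hmono.measure_iUnion, lt_iSup_iff] at hlt
  obtain ⟨k, hk⟩ := hlt
  exact ⟨u k, by simp [u], hk⟩

/-- In a second countable space, countably many open sets approximate all open sets from inside. -/
theorem exists_countable_open_approximation (α : Type*) [TopologicalSpace α]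
    [SecondCountableTopology α] [MeasurableSpace α] :
    ∃ 𝓕 : Set (Set α), 𝓕.Countable ∧ (∀ B ∈ 𝓕, IsOpen B) ∧
      ∀ (μ : Measure α) (A : Set α) (b : ℝ≥0∞), IsOpen A → b < μ A → ∃ B ∈ 𝓕, B ⊆ A ∧ b < μ B := by
  let basis := TopologicalSpace.countableBasis α
  have hbasis := TopologicalSpace.isBasis_countableBasis α
  -- Finite unions of basic sets: still countably many, and those contained in `A` are directed, so
  -- continuity from below applies for every measure at once.
  let 𝓕 : Set (Set α) := Set.sUnion '' {S | S.Finite ∧ S ⊆ basis}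
  have hcount : 𝓕.Countable := (Set.countable_ofPred_finite_subset
    (TopologicalSpace.countable_countableBasis α)).image _
  refine ⟨𝓕, hcount, ?_, fun μ A b hA hb => ?_⟩
  · rintro _ ⟨S, ⟨-, hS⟩, rfl⟩
    exact isOpen_sUnion fun t ht => hbasis.isOpen (hS ht)
  · let T : Set (Set α) := {B | B ∈ 𝓕 ∧ B ⊆ A}
    have hT : A ⊆ ⋃ B ∈ T, B := by
      intro x hx
      obtain ⟨t, ht, hxt, htA⟩ := hbasis.exists_subset_of_mem_open hx hA
      exact Set.mem_biUnion (show t ∈ T from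
        ⟨⟨{t}, ⟨Set.finite_singleton t, by simpa using ht⟩, by simp⟩, htA⟩) hxt
    have hdir : DirectedOn (· ⊆ ·) T := by
      rintro _ ⟨⟨S, ⟨hS, hSb⟩, rfl⟩, hSA⟩ _ ⟨⟨S', ⟨hS', hSb'⟩, rfl⟩, hSA'⟩
      exact ⟨⋃₀ (S ∪ S'), ⟨⟨_, ⟨hS.union hS', Set.union_subset hSb hSb'⟩, rfl⟩,
        by rw [Set.sUnion_union]; exact Set.union_subset hSA hSA'⟩,
        Set.sUnion_subset_sUnion Set.subset_union_left,
        Set.sUnion_subset_sUnion Set.subset_union_right⟩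
    have hlt := hb.trans_le (measure_mono hT)
    rw [measure_biUnion_eq_iSup (hcount.mono fun B hB => hB.1) hdir] at hlt
    simp only [lt_iSup_iff] at hlt
    obtain ⟨B, hB, hbB⟩ := hlt
    exact ⟨B, hB.1, hB.2, hbB⟩

/-! ### Growth of the degrees -/

theorem PNat.cofinite_eq_atTop : (cofinite : Filter ℕ+) = atTop := by
  refine le_antisymm ?_ atTop_le_cofinite
  intro s hs
  obtain ⟨N, hN⟩ := mem_atTop_sets.1 hs
  exact (Set.finite_Iio N).subset fun n hn => not_le.1 fun h => hn (hN n h)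

theorem eventually_pow_le_sqrt {ε : ℕ+ → ℝ} (hε : Tendsto ε atTop (𝓝 0)) {p : ℕ} (hp : p ≠ 0) :
    ∀ᶠ n : ℕ+ in atTop, ((⌊(n : ℝ) ^ ε n⌋₊ : ℝ) + 2) ^ p ≤ Real.sqrt n := by
  have hp0 : (0 : ℝ) < p := by positivity
  have hcast : Tendsto (fun n : ℕ+ => (n : ℝ)) atTop atTop :=
    tendsto_natCast_atTop_atTop.comp tendsto_PNat_val_atTop_atTop
  -- With this exponent the `p`-th power costs `n^(1/4)`; the other factor `n^(1/4)` absorbs `3 ^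
  -- p`, where 3 comes from `x + 2 ≤ 3 * x` for `x ≥ 1`.
  have h1 : ∀ᶠ n : ℕ+ in atTop, ε n < 1 / (4 * p) := hε.eventually_lt_const (by positivity)
  have h2 : ∀ᶠ n : ℕ+ in atTop, (3 : ℝ) ^ p ≤ (n : ℝ) ^ (1 / 4 : ℝ) :=
    ((tendsto_rpow_atTop (by norm_num : (0 : ℝ) < 1 / 4)).comp hcast).eventually_ge_atTop _
  filter_upwards [h1, h2] with n hn1 hn2
  have hn : (1 : ℝ) ≤ n := by exact_mod_cast n.pos
  have h3 : (⌊(n : ℝ) ^ ε n⌋₊ : ℝ) ≤ (n : ℝ) ^ (1 / (4 * p) : ℝ) :=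
    (Nat.floor_le (by positivity)).trans (Real.rpow_le_rpow_of_exponent_le hn hn1.le)
  have h4 : (1 : ℝ) ≤ (n : ℝ) ^ (1 / (4 * p) : ℝ) := Real.one_le_rpow hn (by positivity)
  calc ((⌊(n : ℝ) ^ ε n⌋₊ : ℝ) + 2) ^ p ≤ (3 * (n : ℝ) ^ (1 / (4 * p) : ℝ)) ^ p := by
        gcongr
        linarith
    _ = 3 ^ p * (n : ℝ) ^ (1 / 4 : ℝ) := by
        rw [mul_pow, ← Real.rpow_mul_natCast (by positivity)]
        congr 2
        field_simp
    _ ≤ (n : ℝ) ^ (1 / 4 : ℝ) * (n : ℝ) ^ (1 / 4 : ℝ) := by gcongr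
    _ = Real.sqrt n := by
        rw [← Real.rpow_add (by positivity), Real.sqrt_eq_rpow]
        norm_num

theorem summable_exp_degree_bound {ε : ℕ+ → ℝ} (hε : Tendsto ε atTop (𝓝 0)) {p : ℕ} (hp : p ≠ 0)
    {s : ℝ} (hs : 0 < s) : Summable fun n : ℕ+ =>
      Real.exp (-s ^ 2 * (n : ℝ) / (2 * ((⌊(n : ℝ) ^ ε n⌋₊ : ℝ) + 2) ^ p)) := by
  -- For `y = s² √n / 2`, the bound `exp (-y) ≤ 4! / y ^ 4` equals `24 * 16 / (s ^ 8 n²)`.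
  have hsum : Summable fun n : ℕ+ => (384 / s ^ 8) * (1 / (n : ℝ) ^ 2) :=
    (((Real.summable_one_div_nat_pow (p := 2)).2 one_lt_two).comp_injective
      PNat.coe_injective).mul_left _
  refine Summable.of_norm_bounded_eventually hsum ?_
  rw [PNat.cofinite_eq_atTop]
  filter_upwards [eventually_pow_le_sqrt hε hp] with n hn
  have hn0 : (0 : ℝ) < n := by exact_mod_cast n.pos
  set y : ℝ := s ^ 2 * Real.sqrt n / 2 with hy
  have hy0 : 0 < y := by positivity
  rw [Real.norm_of_nonneg (Real.exp_nonneg _)]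
  calc Real.exp (-s ^ 2 * (n : ℝ) / (2 * ((⌊(n : ℝ) ^ ε n⌋₊ : ℝ) + 2) ^ p)) ≤ Real.exp (-y) := by
        rw [Real.exp_le_exp, neg_mul, neg_div, neg_le_neg_iff, hy]
        calc s ^ 2 * Real.sqrt n / 2 = s ^ 2 * n / (2 * Real.sqrt n) := by
              have := Real.mul_self_sqrt hn0.le
              field_simp
              linarith
          _ ≤ _ := by gcongr
    _ ≤ 24 / y ^ 4 := by
        have := Real.pow_div_factorial_le_exp y hy0.le 4
        rw [Real.exp_neg, inv_le_comm₀ (by positivity) (by positivity), inv_div]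
        simpa [Nat.factorial] using this
    _ = (384 / s ^ 8) * (1 / (n : ℝ) ^ 2) := by
        have : Real.sqrt n ^ 4 = (n : ℝ) ^ 2 := by
          rw [show 4 = 2 * 2 from rfl, pow_mul, Real.sq_sqrt hn0.le]
        rw [hy, div_pow, mul_pow, this]
        field_simp
        norm_num

/-! ### Almost sure convergence -/

theorem ae_eventually_lt_empirical
    (wgt : ProbabilityMeasure (Set.Ioi (0 : ℝ))) (med ini : ProbabilityMeasure ℝ)
    (G : (n : ℕ+) → LoopGraph (Fin n)) (ρ : ProbabilityMeasure GraphClass)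
    (hlim : LocallyWeaklyConverges (fun n => (G n).bare) ρ)
    (ε : ℕ+ → ℝ) (hε : Tendsto ε atTop (𝓝 0))
    (hdeg : ∀ (n : ℕ+) (v : Fin n), ((G n).degree v : ℝ) ≤ (n : ℝ) ^ ε n)
    {Ω : Type*} [MeasurableSpace Ω] (P : Measure Ω)
    (X : (n : ℕ+) → Ω → (G n).Marks)
    (hX : ∀ n, HasLaw (X n) ((G n).iidMarks wgt med ini) P) {B : Set DiffNetClass}
    (hB : IsOpen B) {b : ℝ≥0∞} (hb : b < (markMixture wgt med ini ρ : Measure DiffNetClass) B) :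
    ∀ᵐ a ∂P, ∀ᶠ n in atTop,
      b < (((G n).decorate (X n a)).empirical : Measure DiffNetClass) B := by
  obtain ⟨c, hc, hbc⟩ := exists_lt_measure_infEDist _ hB hb
  obtain ⟨r, hr⟩ := RootedNetwork.exists_radius hc
  -- The gap between `b` and `b'` is the deviation `s` allowed to the sample; the means eventually
  -- exceed `b'`.
  obtain ⟨b', hbb', hb'⟩ := exists_between hbc
  have hb'top : b' ≠ ⊤ := (hb'.trans_le le_top).ne
  have hs : 0 < b'.toReal - b.toReal :=
    sub_pos.2 (ENNReal.toReal_strict_mono hb'top hbb')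
  set s := b'.toReal - b.toReal with hs_def
  set C : Set DiffNetClass := {x | c ≤ Metric.infEDist x Bᶜ} with hC_def
  have hC : MeasurableSet C := (isClosed_le continuous_const Metric.continuous_infEDist).measurableSet
  have hA : IsOpen {x : DiffNetClass | c + c < Metric.infEDist x Bᶜ} :=
    isOpen_lt continuous_const Metric.continuous_infEDist
  have hmean : ∀ᶠ n in atTop, b' < (markMixture wgt med ini (G n).bare.empirical :
      Measure DiffNetClass) {x | c + c < Metric.infEDist x Bᶜ} :=
    eventually_lt_of_lt_liminf (hb'.trans_le (markMixture_le_liminf wgt med ini hlim hA))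
  let bad : (n : ℕ+) → Set (G n).Marks := fun n => {m | (G n).truncatedFrequency r C m ≤
    ∫ m', (G n).truncatedFrequency r C m' ∂((G n).iidMarks wgt med ini) - s}
  have hbad : ∀ n, MeasurableSet (bad n) := fun n =>
    measurableSet_le ((G n).measurable_truncatedFrequency r hC) measurable_const
  have hprob : ∀ n, P {a | X n a ∈ bad n} ≤ ENNReal.ofReal (Real.exp
      (-s ^ 2 * (n : ℝ) / (2 * ((⌊(n : ℝ) ^ ε n⌋₊ : ℝ) + 2) ^ (2 * r + 1)))) := fun n => by
    have h := (G n).iidMarks_truncatedFrequency_le wgt med ini (r := r)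
      (fun x => Nat.le_floor (hdeg n x)) hC hs.le
    rw [Fintype.card_fin] at h
    have hmap : P {a | X n a ∈ bad n} = (G n).iidMarks wgt med ini (bad n) := by
      rw [← (hX n).map_eq, Measure.map_apply_of_aemeasurable (hX n).aemeasurable (hbad n)]
      rfl
    rw [hmap, ← ofReal_measureReal]
    exact ENNReal.ofReal_le_ofReal h
  have hsum : ∑' n, P {a | X n a ∈ bad n} ≠ ⊤ :=
    ne_top_of_le_ne_top (summable_exp_degree_bound hε (Nat.succ_ne_zero _) hs).tsum_ofReal_ne_top
      (ENNReal.tsum_le_tsum hprob)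
  filter_upwards [ae_finite_setOfPred_mem hsum] with a ha
  -- Borel–Cantelli: almost surely only finitely many bad events occur.
  have hgood : ∀ᶠ n in atTop, X n a ∉ bad n := atTop_le_cofinite ha.eventually_cofinite_notMem
  filter_upwards [hgood, hmean] with n hn hn'
  have h1 : ∫ m, (G n).truncatedFrequency r C m ∂((G n).iidMarks wgt med ini) - s <
      (G n).truncatedFrequency r C (X n a) := not_le.1 hn
  have h2 := (G n).truncatedFrequency_le_empirical hr hB.measurableSet (X n a)
  have h3 := (G n).empirical_markKernel_le_integral wgt med ini (B := B) hr
  have h4 := ENNReal.toReal_strict_mono (measure_ne_top _ _) hn'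
  rw [← ENNReal.toReal_lt_toReal (hbb'.trans_le le_top).ne (measure_ne_top _ _)]
  change _ < (((G n).decorate (X n a)).empirical : Measure DiffNetClass).real B
  rw [measureReal_def] at h3
  linarith

end

theorem theorem4p6
    (wgt : ProbabilityMeasure (Set.Ioi (0 : ℝ))) (med ini : ProbabilityMeasure ℝ)
    (G : (n : ℕ+) → LoopGraph (Fin n)) (ρ : ProbabilityMeasure GraphClass)
    (hlim : LocallyWeaklyConverges (fun n => (G n).bare) ρ)
    (ε : ℕ+ → ℝ) (hε : Tendsto ε atTop (𝓝 0))
    (hdeg : ∀ (n : ℕ+) (v : Fin n), ((G n).degree v : ℝ) ≤ (n : ℝ) ^ ε n)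
    {Ω : Type*} [MeasurableSpace Ω] (P : Measure Ω) [IsProbabilityMeasure P]
    (X : (n : ℕ+) → Ω → (G n).Marks)
    (hX : ∀ n, HasLaw (X n) ((G n).iidMarks wgt med ini) P) :
    ∀ᵐ a ∂P, LocallyWeaklyConverges (fun n => (G n).decorate (X n a))
      (markMixture wgt med ini ρ) := by
  obtain ⟨𝓕, h𝓕, hopen, happrox⟩ := exists_countable_open_approximation DiffNetClass
  -- Countably many pairs of an open set and a rational level, so a single null set serves all of
  -- them.
  have hae : ∀ᵐ a ∂P, ∀ B ∈ 𝓕, ∀ q : ℚ,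
      ENNReal.ofReal q < (markMixture wgt med ini ρ : Measure DiffNetClass) B →
      ∀ᶠ n in atTop, ENNReal.ofReal q <
        (((G n).decorate (X n a)).empirical : Measure DiffNetClass) B := by
    rw [ae_ball_iff h𝓕]
    intro B hB
    rw [ae_all_iff]
    intro q
    by_cases h : ENNReal.ofReal q < (markMixture wgt med ini ρ : Measure DiffNetClass) B
    · filter_upwards [ae_eventually_lt_empirical wgt med ini G ρ hlim ε hε hdeg P X hX
        (hopen B hB) h] with a ha _ using ha
    · exact Eventually.of_forall fun a ha => absurd ha h
  filter_upwards [hae] with a ha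
  -- Portmanteau: for probability measures, lower bounds on open sets are enough.
  refine tendsto_of_forall_isOpen_le_liminf' fun A hA => le_of_forall_lt fun b hb => ?_
  obtain ⟨q, -, hbq, hq⟩ := ENNReal.lt_iff_exists_rat_btwn.1 hb
  obtain ⟨B, hB, hBA, hqB⟩ := happrox _ A _ hA hq
  refine hbq.trans_le (le_liminf_of_le (by isBoundedDefault) ?_)
  filter_upwards [ha B hB q hqB] with n hn
  exact hn.le.trans (measure_mono hBA)
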